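/- Identify the plane with $\mathbb{C}$. A generalized closed disc is a closed disc of positive radius, a closed half-plane, or the closed exterior $\{z : |z-c|\ge r\}$ of a circle ($r>0$). Two such discs are tangent if their interiors are disjoint and their boundaries meet in exactly one point (the point at infinity for two disjoint half-planes). Let $C_0$ be a circle with center $c_0$ and radius $r_0>0$, bounding the closed disc $D_0$. For a generalized disc $D$ tangent to $D_0$, let $\alpha(D)$, defined modulo $2\pi$, be the angle such that $D$ touches $D_0$ at $c_0+r_0e^{i\alpha(D)}$. Let $D_1,D_2$ be tangent generalized discs, both tangent to $D_0$, with angles represented by $\theta_1<\theta_2<\theta_1+2\pi$. For tangent $D,D'$, both tangent to $D_0$, whose angles have representatives $\theta<\theta'$ in $[\theta_1,\theta_2]$, the successor $s(D,D')$ is the generalized disc that is tangent to $D_0$, $D$ and $D'$ and has an angle strictly between $\theta$ and $\theta'$. Let $\mathcal{C}$ be the smallest family containing $D_1,D_2$ and containing $s(D,D')$ for all tangent $D,D'\in\mathcal{C}$; the angles of its members are taken in $[\theta_1,\theta_2]$. A continuous curve $\gamma:[\theta_1,\theta_2]\to\mathbb{C}$ is an Apollonian curve for $(C_0,D_1,D_2)$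 on $[\theta_1,\theta_2]$ if, for all tangent $D,D'\in\mathcal{C}$, $$\gamma(\alpha(D))-\gamma(\alpha(D'))\in\mathbb{R}\,e^{i\alpha(s(D,D'))/2}.$$ Let $D_1,D_2,D_3$ be pairwise tangent generalized discs, each tangent to $D_0$, with angles represented by $\theta_1<\theta_2<\theta_3<\theta_1+2\pi$. Let $\gamma_{12},\gamma_{23},\gamma_{31}$ be Apollonian curves for $(C_0,D_1,D_2)$, $(C_0,D_2,D_3)$, $(C_0,D_3,D_1)$ on $[\theta_1,\theta_2]$, $[\theta_2,\theta_3]$, $[\theta_3,\theta_1+2\pi]$, respectively, with $\gamma_{12}(\theta_2)=\gamma_{23}(\theta_2)$, $\gamma_{23}(\theta_3)=\gamma_{31}(\theta_3)$ and $\gamma_{31}(\theta_1+2\pi)=\gamma_{12}(\theta_1)$. The closed region enclosed by the three curves (the union of their images and of the bounded components of the complement of these images) is called an Apollonian triangle, and the three common endpoints are its vertices. Theorem. For any three points $v_1,v_2,v_3$ of the plane in general position (that is, not collinear), there is a unique Apollonian triangle whose vertices are $v_1,v_2,v_3$. -/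

import Mathlib

/-- Generalized closed discs in the plane `ℂ`: the closures of the components of the complement
of a generalized circle (a circle of positive radius or a line).  They are
* `ball c r`: the closed disc `{z | dist z c ≤ r}`,
* `half n t`: the closed half-plane `{z | t ≤ ⟪n, z⟫}` (with `n` a unit vector),
* `coball c r`: the closed exterior `{z | r ≤ dist z c}` of a circle. -/
inductive GDisc : Type
  | ball (c : ℂ) (r : ℝ) (hr : 0 < r) : GDisc
  | half (n : ℂ) (t : ℝ) (hn : ‖n‖ = 1) : GDisc
  | coball (c : ℂ) (r : ℝ) (hr : 0 < r) : GDisc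

namespace GDisc

/-- The generalized circle bounding a generalized closed disc. -/
def circle : GDisc → Set ℂ
  | ball c r _ => {z | dist z c = r}
  | half n t _ => {z | inner ℝ n z = t}
  | coball c r _ => {z | dist z c = r}

/-- Tangency of generalized closed discs: the interiors are disjoint and the boundary circles
touch at exactly one point, which is the point at infinity for two half-planes (bounded by
distinct parallel lines).  Written out by cases in terms of centres and radii.  Two bounded discs
are tangent iff their circles are externally tangent; a bounded disc and the exterior of a circle
are tangent iff the circle of the former is internally tangent to that of the latter; an exterior
always overlaps with half-planes and with other exteriors. -/
def Tangent : GDisc → GDisc → Prop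
  | ball c r _, ball c' r' _ => dist c c' = r + r'
  | ball c r _, half n t _ => inner ℝ n c = t - r
  | half n t _, ball c r _ => inner ℝ n c = t - r
  | ball c r _, coball c' r' _ => r < r' ∧ dist c c' = r' - r
  | coball c' r' _, ball c r _ => r < r' ∧ dist c c' = r' - r
  | half n t _, half n' t' _ => n' = -n ∧ 0 < t + t'
  | half _ _ _, coball _ _ _ => False
  | coball _ _ _, half _ _ _ => False
  | coball _ _ _, coball _ _ _ => False

end GDisc

/-- A proper circle (of positive radius) in the plane. -/
structure ProperCircle where
  center : ℂ
  radius : ℝ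
  radius_pos : 0 < radius

namespace ProperCircle

/-- The bounded closed disc of a proper circle. -/
def disc (C₀ : ProperCircle) : GDisc := GDisc.ball C₀.center C₀.radius C₀.radius_pos

/-- The point of `C₀` at angle `θ`. -/
noncomputable def point (C₀ : ProperCircle) (θ : ℝ) : ℂ :=
  C₀.center + C₀.radius * Complex.exp (θ * Complex.I)

/-- `D` is tangent to (the bounded disc of) `C₀`, at the point of `C₀` at angle `θ`.  If `D` is a
bounded disc with centre `c`, this `θ` is the angle of `c - C₀.center` with the positive axis. -/
def TouchesAt (C₀ : ProperCircle) (D : GDisc) (θ : ℝ) : Prop :=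
  C₀.disc.Tangent D ∧ C₀.point θ ∈ D.circle

end ProperCircle

/-- `S` is the successor of the pair `D, D'` of discs tangent to `C₀` at the angles `θ < θ'`: the
Soddy circle of `C₀, D, D'` (a circle tangent to all three) which touches `C₀` at an angle `φ`
strictly between `θ` and `θ'`, i.e. which lies in the region enclosed by the three circles that is
adjacent to the arc `(θ, θ')` of `C₀`. -/
structure IsSuccessor (C₀ : ProperCircle) (D : GDisc) (θ : ℝ) (D' : GDisc) (θ' : ℝ)
    (S : GDisc) (φ : ℝ) : Prop where
  left_lt : θ < φ
  lt_right : φ < θ'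
  touches : C₀.TouchesAt S φ
  tangent_left : S.Tangent D
  tangent_right : S.Tangent D'

/-- The smallest family of discs tangent to `C₀` (each recorded with its angle in `[θ₁, θ₂]`) which
contains `D₁, D₂` and is closed under adding successors of tangent pairs. -/
inductive ApollonianFamily (C₀ : ProperCircle) (D₁ : GDisc) (θ₁ : ℝ) (D₂ : GDisc) (θ₂ : ℝ) :
    GDisc → ℝ → Prop
  | left : ApollonianFamily C₀ D₁ θ₁ D₂ θ₂ D₁ θ₁
  | right : ApollonianFamily C₀ D₁ θ₁ D₂ θ₂ D₂ θ₂
  | successor {D : GDisc} {θ : ℝ} {D' : GDisc} {θ' : ℝ} {S : GDisc} {φ : ℝ}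
      (hD : ApollonianFamily C₀ D₁ θ₁ D₂ θ₂ D θ)
      (hD' : ApollonianFamily C₀ D₁ θ₁ D₂ θ₂ D' θ')
      (htan : D.Tangent D') (hS : IsSuccessor C₀ D θ D' θ' S φ) :
      ApollonianFamily C₀ D₁ θ₁ D₂ θ₂ S φ

/-- `γ`, restricted to `[θ₁, θ₂]`, is an Apollonian curve associated to `C₀, D₁, D₂`, where `D₁, D₂`
touch `C₀` at the angles `θ₁ < θ₂`: it is continuous and for every tangent pair `D, D'` of the
family, with successor touching `C₀` at angle `φ`, the chord `γ θ - γ θ'` is a real multiple of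
`exp (i φ / 2)`, a complex square root of the direction of the successor seen from the centre. -/
def IsApollonianCurve (C₀ : ProperCircle) (D₁ : GDisc) (θ₁ : ℝ) (D₂ : GDisc) (θ₂ : ℝ)
    (γ : ℝ → ℂ) : Prop :=
  ContinuousOn γ (Set.Icc θ₁ θ₂) ∧
  ∀ (D : GDisc) (θ : ℝ) (D' : GDisc) (θ' : ℝ) (S : GDisc) (φ : ℝ),
    ApollonianFamily C₀ D₁ θ₁ D₂ θ₂ D θ → ApollonianFamily C₀ D₁ θ₁ D₂ θ₂ D' θ' →
    D.Tangent D' → IsSuccessor C₀ D θ D' θ' S φ →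
    ∃ t : ℝ, γ θ - γ θ' = t * Complex.exp ((φ / 2 : ℝ) * Complex.I)

/-- The closed region enclosed by a set `K`: `K` with all bounded components of its complement. -/
def enclosedRegion (K : Set ℂ) : Set ℂ :=
  K ∪ {z | z ∉ K ∧ Bornology.IsBounded (connectedComponentIn Kᶜ z)}

/-- The data of an Apollonian triangle: a proper circle `C₀` and three pairwise tangent discs
`D₁, D₂, D₃` tangent to `C₀` (so that all four discs have disjoint interiors), labelled in
counterclockwise order of their angles on `C₀`; and for each of the three arcs into which the
tangency points divide `C₀` an Apollonian curve, consecutive curves having a common endpoint. -/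
structure IsApollonianConfiguration (C₀ : ProperCircle) (D₁ D₂ D₃ : GDisc) (θ₁ θ₂ θ₃ : ℝ)
    (γ₁₂ γ₂₃ γ₃₁ : ℝ → ℂ) : Prop where
  touches₁ : C₀.TouchesAt D₁ θ₁
  touches₂ : C₀.TouchesAt D₂ θ₂
  touches₃ : C₀.TouchesAt D₃ θ₃
  tangent₁₂ : D₁.Tangent D₂
  tangent₂₃ : D₂.Tangent D₃
  tangent₃₁ : D₃.Tangent D₁
  lt₁₂ : θ₁ < θ₂
  lt₂₃ : θ₂ < θ₃
  lt₃₁ : θ₃ < θ₁ + 2 * Real.pi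
  curve₁₂ : IsApollonianCurve C₀ D₁ θ₁ D₂ θ₂ γ₁₂
  curve₂₃ : IsApollonianCurve C₀ D₂ θ₂ D₃ θ₃ γ₂₃
  curve₃₁ : IsApollonianCurve C₀ D₃ θ₃ D₁ (θ₁ + 2 * Real.pi) γ₃₁
  vertex₂ : γ₁₂ θ₂ = γ₂₃ θ₂
  vertex₃ : γ₂₃ θ₃ = γ₃₁ θ₃
  vertex₁ : γ₃₁ (θ₁ + 2 * Real.pi) = γ₁₂ θ₁

/-- `T` is an Apollonian triangle with vertex set `V`: the region enclosed by the three Apollonian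
curves of some configuration, whose common endpoints are the points of `V`. -/
def IsApollonianTriangle (T V : Set ℂ) : Prop :=
  ∃ (C₀ : ProperCircle) (D₁ D₂ D₃ : GDisc) (θ₁ θ₂ θ₃ : ℝ) (γ₁₂ γ₂₃ γ₃₁ : ℝ → ℂ),
    IsApollonianConfiguration C₀ D₁ D₂ D₃ θ₁ θ₂ θ₃ γ₁₂ γ₂₃ γ₃₁ ∧
    V = {γ₁₂ θ₁, γ₂₃ θ₂, γ₃₁ θ₃} ∧
    T = enclosedRegion (γ₁₂ '' Set.Icc θ₁ θ₂ ∪ γ₂₃ '' Set.Icc θ₂ θ₃ ∪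
      γ₃₁ '' Set.Icc θ₃ (θ₁ + 2 * Real.pi))

/-! Give a disc touching `C₀` (radius `a`) at angle `θ` the spinor of argument `θ / 2` whose squared
length is `1 + a·κ`, with `κ` the signed curvature of the disc. Tangency of two such discs then
becomes linear algebra: their spinors have symplectic product `±1`
(`TouchesAt.tangent_iff_cross_sq`), and for angles in increasing order, less than a turn apart, the
sign is `+`. Hence the successor of a pair has the sum of the two spinors (`spinor_successor`), and
the family of `D₁, D₂` with spinors `u, w` is a Farey tree of combinations `p u + q w`.

A curve is Apollonian when its chord between tangent discs with spinors `x, y` is parallel to `x +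
y`. If that chord is `t (x + y)`, the chords to and from the successor are multiples of `2x + y` and
`x + 2y` adding up to it, so both factors are `t / 3`. Thus the values on the family are forced by
the two endpoints, and density of the angles fixes the curve (`IsApollonianCurve.eq_zero`).
Conversely the rule is a self-similarity with ratio `1/3` in changing bases; its fixed point
`baseCurve` yields a curve for every pair. The trace depends only on the starting point and on `t
u`, `t w`.

In a configuration the third spinor must be `w - u`, since a full turn changes the sign of `u`.
Closing up the three chords leaves one real scale `t`, and the centroid `m` of the vertices `a, b,
c` satisfies `m - a = t u`, `b - m = t w`. So the vertices determine all three traces, and they are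
listed clockwise because `cross (b - a) (c - a) = -3 t²`. Conversely, for clockwise vertices these
equations can be solved for `t, u, w` with `cross u w = 1`, and every nonzero vector is a spinor. -/

/-! ### Symplectic form and polar coordinates. -/

/-- The standard symplectic form on the real plane `ℂ`. -/
def cross (z w : ℂ) : ℝ := z.re * w.im - z.im * w.re

lemma cross_mul_exp (a b α β : ℝ) :
    cross (a * Complex.exp (α * Complex.I)) (b * Complex.exp (β * Complex.I)) =
      a * b * Real.sin (β - α) := by
  simp only [cross, Complex.mul_re, Complex.mul_im, Complex.ofReal_re, Complex.ofReal_im,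
    Complex.exp_ofReal_mul_I_re, Complex.exp_ofReal_mul_I_im, Real.sin_sub]
  ring

/-- A pair with `cross u w = 1` is a basis of the plane. -/
lemma eq_smul_add_smul_of_cross_eq_one {u w : ℂ} (h : cross u w = 1) (z : ℂ) :
    z = (cross z w : ℝ) * u + (cross u z : ℝ) * w := by
  simp only [cross] at h ⊢
  apply Complex.ext
  · simp
    linear_combination (-z.re) * h
  · simp
    linear_combination (-z.im) * h

lemma lt_of_cross_pos {a b α β : ℝ} (ha : 0 < a) (hb : 0 < b) (hαβ : α < β + Real.pi)
    (h : 0 < cross (a * Complex.exp (α * Complex.I)) (b * Complex.exp (β * Complex.I))) :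
    α < β := by
  rw [cross_mul_exp] at h
  by_contra! hle
  have hs : Real.sin (β - α) ≤ 0 :=
    Real.sin_nonpos_of_nonpos_of_neg_pi_le (by linarith) (by linarith)
  nlinarith [mul_pos ha hb]

/-- Polar coordinates of a vector on the left of a given ray. -/
lemma exists_polar_of_cross_pos {a α : ℝ} (ha : 0 < a) {η : ℂ}
    (h : 0 < cross (a * Complex.exp (α * Complex.I)) η) :
    ∃ b β : ℝ, 0 < b ∧ α < β ∧ β < α + Real.pi ∧ η = b * Complex.exp (β * Complex.I) := by
  set z : ℂ := η * Complex.exp ((-α : ℝ) * Complex.I) with hz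
  have hη : η = z * Complex.exp (α * Complex.I) := by
    rw [hz, mul_assoc, ← Complex.exp_add]
    simp
  have him : 0 < z.im := by
    have : cross (a * Complex.exp (α * Complex.I)) η = a * z.im := by
      simp only [cross, hz, Complex.mul_re, Complex.mul_im, Complex.ofReal_re, Complex.ofReal_im,
        Complex.exp_ofReal_mul_I_re, Complex.exp_ofReal_mul_I_im, Real.sin_neg, Real.cos_neg]
      ring
    rw [this] at h
    exact (pos_iff_pos_of_mul_pos h).1 ha
  have hz0 : z ≠ 0 := fun h0 => by simp [h0] at him
  have h0 : 0 ≤ z.arg := Complex.arg_nonneg_iff.2 him.le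
  have h0' : z.arg ≠ 0 := fun h => him.ne' (Complex.arg_eq_zero_iff.1 h).2
  have hpi : z.arg ≠ Real.pi := fun h => him.ne' (Complex.arg_eq_pi_iff.1 h).2
  refine ⟨‖z‖, α + z.arg, norm_pos_iff.2 hz0, ?_, ?_, ?_⟩
  · linarith [lt_of_le_of_ne h0 h0'.symm]
  · linarith [lt_of_le_of_ne (Complex.arg_le_pi z) hpi]
  · rw [hη]
    conv_lhs => rw [← Complex.norm_mul_exp_arg_mul_I z]
    rw [mul_assoc, ← Complex.exp_add]
    congr 2
    push_cast
    ring

/-! ### Discs touching `C₀`: relative curvature and the tangency equation. -/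

/-- If the distance to `c₀ + a e` and to `c₀` are as for the point `c₀ + (a + R) e`, it is that
point. -/
lemma sub_eq_mul_of_norm_sq {d : ℂ} {a R θ : ℝ} (ha : 0 < a)
    (h₁ : ‖d‖ ^ 2 = (a + R) ^ 2) (h₂ : ‖a * Complex.exp (θ * Complex.I) - d‖ ^ 2 = R ^ 2) :
    d = (a + R : ℝ) * Complex.exp (θ * Complex.I) := by
  rw [Complex.sq_norm, Complex.normSq_apply] at h₁ h₂
  simp only [Complex.sub_re, Complex.sub_im, Complex.mul_re, Complex.mul_im, Complex.ofReal_re,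
    Complex.ofReal_im, Complex.exp_ofReal_mul_I_re, Complex.exp_ofReal_mul_I_im] at h₁ h₂
  have hcs := Real.cos_sq_add_sin_sq θ
  have hin : d.re * Real.cos θ + d.im * Real.sin θ = a + R := by
    have : a * (d.re * Real.cos θ + d.im * Real.sin θ) = a * (a + R) := by
      linear_combination (1 / 2) * h₁ - (1 / 2) * h₂ + (a ^ 2 / 2) * hcs
    exact mul_left_cancel₀ ha.ne' this
  have hz : (d.re - (a + R) * Real.cos θ) ^ 2 + (d.im - (a + R) * Real.sin θ) ^ 2 = 0 := by
    linear_combination h₁ - 2 * (a + R) * hin + (a + R) ^ 2 * hcs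
  apply Complex.ext
  · simp only [Complex.mul_re, Complex.ofReal_re, Complex.ofReal_im, Complex.exp_ofReal_mul_I_re]
    nlinarith [sq_nonneg (d.im - (a + R) * Real.sin θ),
      sq_nonneg (d.re - (a + R) * Real.cos θ),
      pow_eq_zero_iff (n := 2) (by norm_num) |>.1 (le_antisymm (by
        nlinarith [sq_nonneg (d.im - (a + R) * Real.sin θ)])
        (sq_nonneg (d.re - (a + R) * Real.cos θ)))]
  · simp only [Complex.mul_im, Complex.ofReal_re, Complex.ofReal_im, Complex.exp_ofReal_mul_I_im]
    nlinarith [pow_eq_zero_iff (n := 2) (by norm_num) |>.1 (le_antisymm (by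
        nlinarith [sq_nonneg (d.re - (a + R) * Real.cos θ)])
        (sq_nonneg (d.im - (a + R) * Real.sin θ)))]

lemma norm_sq_mul_exp_sub (a b θ φ : ℝ) :
    ‖(a * Complex.exp (θ * Complex.I) - b * Complex.exp (φ * Complex.I) : ℂ)‖ ^ 2 =
      (a - b) ^ 2 + 2 * a * b * (1 - Real.cos (φ - θ)) := by
  rw [Complex.sq_norm, Complex.normSq_apply]
  simp only [Complex.sub_re, Complex.sub_im, Complex.mul_re, Complex.mul_im, Complex.ofReal_re,
    Complex.ofReal_im, Complex.exp_ofReal_mul_I_re, Complex.exp_ofReal_mul_I_im, Real.cos_sub]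
  linear_combination a ^ 2 * Real.cos_sq_add_sin_sq θ + b ^ 2 * Real.cos_sq_add_sin_sq φ

lemma inner_exp_exp (θ φ : ℝ) :
    inner ℝ (Complex.exp (θ * Complex.I)) (Complex.exp (φ * Complex.I)) = Real.cos (φ - θ) := by
  simp only [Complex.inner, Complex.mul_re, Complex.conj_re, Complex.conj_im,
    Complex.exp_ofReal_mul_I_re, Complex.exp_ofReal_mul_I_im, Real.cos_sub]
  ring

namespace GDisc

/-- One plus the signed curvature of a generalized disc, in units in which the curvature of the
reference circle (of radius `a`) is one. -/
noncomputable def relCurvature (a : ℝ) : GDisc → ℝ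
  | ball _ r _ => 1 + a / r
  | half _ _ _ => 1
  | coball _ r _ => 1 - a / r

end GDisc

namespace ProperCircle

variable {C₀ : ProperCircle} {D D' : GDisc} {θ θ' : ℝ}

lemma touchesAt_ball_iff {c : ℂ} {r : ℝ} {hr : 0 < r} :
    C₀.TouchesAt (.ball c r hr) θ ↔
      c = C₀.center + (C₀.radius + r : ℝ) * Complex.exp (θ * Complex.I) := by
  have ha := C₀.radius_pos
  constructor
  · rintro ⟨h₁, h₂⟩
    simp only [disc, GDisc.Tangent, GDisc.circle, point, Set.mem_ofPred_eq] at h₁ h₂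
    rw [dist_comm, dist_eq_norm] at h₁
    rw [dist_eq_norm] at h₂
    have := sub_eq_mul_of_norm_sq (d := c - C₀.center) (R := r) (θ := θ) ha (by rw [h₁])
      (by rw [← h₂]; congr 2; ring)
    rw [← this]; ring
  · rintro rfl
    constructor
    · simp only [disc, GDisc.Tangent]
      rw [dist_eq_norm]
      simp only [sub_add_cancel_left, norm_neg, norm_mul, Complex.norm_real,
        Complex.norm_exp_ofReal_mul_I, mul_one, Real.norm_eq_abs]
      exact abs_of_pos (by positivity)
    · simp only [GDisc.circle, point, Set.mem_ofPred_eq]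
      rw [dist_eq_norm]
      rw [show C₀.center + C₀.radius * Complex.exp (θ * Complex.I) -
        (C₀.center + (C₀.radius + r : ℝ) * Complex.exp (θ * Complex.I)) =
        (-r : ℝ) * Complex.exp (θ * Complex.I) by push_cast; ring]
      simp [abs_of_pos hr]

lemma touchesAt_half_iff {n : ℂ} {t : ℝ} {hn : ‖n‖ = 1} :
    C₀.TouchesAt (.half n t hn) θ ↔
      n = Complex.exp (θ * Complex.I) ∧ t = inner ℝ n C₀.center + C₀.radius := by
  have ha := C₀.radius_pos
  simp only [TouchesAt, disc, GDisc.Tangent, GDisc.circle, point, Set.mem_ofPred_eq, inner_add_right]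
  have hmul : inner ℝ n (C₀.radius * Complex.exp (θ * Complex.I)) =
      C₀.radius * inner ℝ n (Complex.exp (θ * Complex.I)) := by
    rw [← Complex.real_smul, inner_smul_right]
  rw [hmul]
  constructor
  · rintro ⟨h₁, h₂⟩
    have : inner ℝ n (Complex.exp (θ * Complex.I)) = (1 : ℝ) := by
      apply mul_left_cancel₀ ha.ne'
      linarith
    refine ⟨?_, by linarith⟩
    exact (inner_eq_one_iff_of_norm_eq_one hn (Complex.norm_exp_ofReal_mul_I θ)).1 this
  · rintro ⟨h₁, h₂⟩
    have : inner ℝ n (Complex.exp (θ * Complex.I)) = (1 : ℝ) :=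
      (inner_eq_one_iff_of_norm_eq_one hn (Complex.norm_exp_ofReal_mul_I θ)).2 h₁
    rw [this]
    exact ⟨by linarith, by linarith⟩

lemma touchesAt_coball_iff {c : ℂ} {r : ℝ} {hr : 0 < r} :
    C₀.TouchesAt (.coball c r hr) θ ↔
      C₀.radius < r ∧ c = C₀.center + (C₀.radius - r : ℝ) * Complex.exp (θ * Complex.I) := by
  have ha := C₀.radius_pos
  constructor
  · rintro ⟨⟨hlt, h₁⟩, h₂⟩
    simp only [GDisc.circle, point, Set.mem_ofPred_eq] at h₂
    rw [dist_comm, dist_eq_norm] at h₁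
    rw [dist_eq_norm] at h₂
    have := sub_eq_mul_of_norm_sq (d := c - C₀.center) (R := -r) (θ := θ) ha (by rw [h₁]; ring)
      (by rw [neg_sq, ← h₂]; congr 2; ring)
    refine ⟨hlt, ?_⟩
    rw [sub_eq_add_neg, ← this]; ring
  · rintro ⟨hlt, rfl⟩
    refine ⟨⟨hlt, ?_⟩, ?_⟩
    · rw [dist_eq_norm]
      simp only [sub_add_cancel_left, norm_neg, norm_mul, Complex.norm_real,
        Complex.norm_exp_ofReal_mul_I, mul_one, Real.norm_eq_abs]
      rw [abs_of_neg (by linarith)]; ring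
    · simp only [GDisc.circle, point, Set.mem_ofPred_eq]
      rw [dist_eq_norm]
      rw [show C₀.center + C₀.radius * Complex.exp (θ * Complex.I) -
        (C₀.center + (C₀.radius - r : ℝ) * Complex.exp (θ * Complex.I)) =
        (r : ℝ) * Complex.exp (θ * Complex.I) by push_cast; ring]
      simp [abs_of_pos hr]

lemma TouchesAt.relCurvature_pos (h : C₀.TouchesAt D θ) : 0 < D.relCurvature C₀.radius := by
  have ha := C₀.radius_pos
  cases D with
  | ball c r hr => simp only [GDisc.relCurvature]; positivity
  | half n t hn => simp only [GDisc.relCurvature]; positivity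
  | coball c r hr =>
    have := (touchesAt_coball_iff.1 h).1
    simp only [GDisc.relCurvature, sub_pos]
    exact (div_lt_one hr).2 this

/-- Every positive value of the relative curvature occurs at every point of the circle. -/
lemma exists_touchesAt (C₀ : ProperCircle) (θ : ℝ) {k : ℝ} (hk : 0 < k) :
    ∃ D : GDisc, C₀.TouchesAt D θ ∧ D.relCurvature C₀.radius = k := by
  have ha := C₀.radius_pos
  rcases lt_trichotomy k 1 with h | rfl | h
  · have hr : 0 < C₀.radius / (1 - k) := div_pos ha (by linarith)
    refine ⟨.coball _ _ hr, touchesAt_coball_iff.2 ⟨?_, rfl⟩, ?_⟩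
    · rw [lt_div_iff₀ (by linarith)]; nlinarith
    · simp only [GDisc.relCurvature]
      have : 1 - k ≠ 0 := by linarith
      field_simp
      ring
  · exact ⟨.half _ _ (Complex.norm_exp_ofReal_mul_I θ), touchesAt_half_iff.2 ⟨rfl, rfl⟩, rfl⟩
  · have hr : 0 < C₀.radius / (k - 1) := div_pos ha (by linarith)
    refine ⟨.ball _ _ hr, touchesAt_ball_iff.2 rfl, ?_⟩
    simp only [GDisc.relCurvature]
    have : k - 1 ≠ 0 := by linarith
    field_simp
    ring

end ProperCircle

lemma GDisc.Tangent.symm {D D' : GDisc} (h : D.Tangent D') : D'.Tangent D := by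
  cases D <;> cases D' <;> simp only [GDisc.Tangent] at h ⊢
  · rw [dist_comm, h, add_comm]
  · exact h
  · exact h
  · exact h
  · exact ⟨by rw [h.1, neg_neg], by linarith [h.2]⟩
  · exact h

namespace ProperCircle

variable {C₀ : ProperCircle} {D D' : GDisc} {θ θ' : ℝ}

/-- Two discs touching `C₀` are tangent iff their relative curvatures and the angle between their
points of contact satisfy one equation. -/
lemma TouchesAt.tangent_iff (h : C₀.TouchesAt D θ) (h' : C₀.TouchesAt D' θ') :
    D.Tangent D' ↔
      D.relCurvature C₀.radius * D'.relCurvature C₀.radius * (1 - Real.cos (θ' - θ)) = 2 := by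
  have ha := C₀.radius_pos
  set a := C₀.radius with hadef
  have hc0 : 0 ≤ 1 - Real.cos (θ' - θ) := by linarith [Real.cos_le_one (θ' - θ)]
  have hc2 : 1 - Real.cos (θ' - θ) ≤ 2 := by linarith [Real.neg_one_le_cos (θ' - θ)]
  have hdist (x y : ℝ) : dist (C₀.center + (x : ℝ) * Complex.exp (θ * Complex.I))
      (C₀.center + (y : ℝ) * Complex.exp (θ' * Complex.I)) ^ 2 =
      (x - y) ^ 2 + 2 * x * y * (1 - Real.cos (θ' - θ)) := by
    rw [dist_eq_norm, add_sub_add_left_eq_sub, norm_sq_mul_exp_sub]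
  have hinner (φ ψ x : ℝ) : inner ℝ (Complex.exp (φ * Complex.I))
      (C₀.center + (x : ℝ) * Complex.exp (ψ * Complex.I)) =
      inner ℝ (Complex.exp (φ * Complex.I)) C₀.center + x * Real.cos (ψ - φ) := by
    rw [inner_add_right, ← Complex.real_smul (x := x), inner_smul_right, inner_exp_exp]
  have hneg : Real.cos (θ - θ') = Real.cos (θ' - θ) := by rw [← Real.cos_neg]; ring_nf
  -- Serves disc against exterior in both orders. The condition `r < r'` comes for free from the
  -- equation, because `1 - cos ≤ 2` forces `r' - r ≥ a`.
  have hcoball (r r' : ℝ) (hr : 0 < r) (har' : a < r') (hr' : 0 < r')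
      (x : ℝ) (hx : 0 ≤ x)
      (hx2 : x ^ 2 = (a + r - (a - r')) ^ 2 + 2 * (a + r) * (a - r') * (1 - Real.cos (θ' - θ))) :
      (r < r' ∧ x = r' - r) ↔ (1 + a / r) * (1 - a / r') * (1 - Real.cos (θ' - θ)) = 2 := by
    have e : (1 + a / r) * (1 - a / r') * (1 - Real.cos (θ' - θ)) = 2 ↔
        (r + a) * (r' - a) * (1 - Real.cos (θ' - θ)) = 2 * r * r' := by
      field_simp
    rw [e]
    constructor
    · rintro ⟨h1, rfl⟩; nlinarith
    · intro h1
      have hlt : r < r' := by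
        have : 2 * r * r' ≤ (r + a) * (r' - a) * 2 := by
          rw [← h1]
          exact mul_le_mul_of_nonneg_left hc2 (by nlinarith)
        nlinarith
      refine ⟨hlt, ?_⟩
      rw [← abs_of_nonneg hx, ← abs_of_pos (sub_pos.2 hlt), ← sq_eq_sq_iff_abs_eq_abs]
      nlinarith
  cases D with
  | ball c r hr =>
    rw [touchesAt_ball_iff] at h
    cases D' with
    | ball c' r' hr' =>
      rw [touchesAt_ball_iff] at h'
      simp only [GDisc.Tangent, GDisc.relCurvature]
      rw [h, h', ← hadef]
      have hd := hdist (a + r) (a + r')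
      have e : (1 + a / r) * (1 + a / r') * (1 - Real.cos (θ' - θ)) = 2 ↔
          (r + a) * (r' + a) * (1 - Real.cos (θ' - θ)) = 2 * r * r' := by
        field_simp
      rw [e, ← sq_eq_sq₀ dist_nonneg (by positivity), hd]
      constructor <;> intro h <;> nlinarith
    | half n t hn =>
      obtain ⟨rfl, ht⟩ := touchesAt_half_iff.1 h'
      simp only [GDisc.Tangent, GDisc.relCurvature]
      rw [h, ht, hinner, hneg, ← hadef]
      have e : (1 + a / r) * 1 * (1 - Real.cos (θ' - θ)) = 2 ↔
          (r + a) * (1 - Real.cos (θ' - θ)) = 2 * r := by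
        field_simp
      rw [e]
      constructor <;> intro h <;> linarith
    | coball c' r' hr' =>
      obtain ⟨hlt, h'⟩ := touchesAt_coball_iff.1 h'
      simp only [GDisc.Tangent, GDisc.relCurvature]
      rw [h, h', ← hadef]
      exact hcoball r r' hr hlt hr' _ dist_nonneg (hdist _ _)
  | half n t hn =>
    obtain ⟨rfl, ht⟩ := touchesAt_half_iff.1 h
    cases D' with
    | ball c' r' hr' =>
      rw [touchesAt_ball_iff] at h'
      simp only [GDisc.Tangent, GDisc.relCurvature]
      rw [h', ht, hinner, ← hadef]
      have e : 1 * (1 + a / r') * (1 - Real.cos (θ' - θ)) = 2 ↔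
          (r' + a) * (1 - Real.cos (θ' - θ)) = 2 * r' := by
        field_simp
      rw [e]
      constructor <;> intro h <;> linarith
    | half n' t' hn' =>
      obtain ⟨rfl, ht'⟩ := touchesAt_half_iff.1 h'
      simp only [GDisc.Tangent, GDisc.relCurvature]
      have e : Complex.exp (θ' * Complex.I) = -Complex.exp (θ * Complex.I) ↔
          Real.cos (θ' - θ) = -1 := by
        rw [← inner_exp_exp, ← inner_eq_one_iff_of_norm_eq_one (𝕜 := ℝ)
          (Complex.norm_exp_ofReal_mul_I θ')
          (by rw [norm_neg]; exact Complex.norm_exp_ofReal_mul_I θ), inner_neg_right,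
          real_inner_comm]
        constructor <;> intro h <;> linarith
      constructor
      · rintro ⟨h, -⟩
        rw [e.1 h]; norm_num
      · intro h
        have h1 := e.2 (by linarith)
        -- With opposite normals the two offsets add up to `2a > 0`.
        refine ⟨h1, ?_⟩
        rw [ht, ht', h1, inner_neg_left]
        linarith
    | coball c' r' hr' =>
      obtain ⟨hlt, h'⟩ := touchesAt_coball_iff.1 h'
      simp only [GDisc.Tangent, GDisc.relCurvature, false_iff]
      -- A product of curvatures below `1`, times `1 - cos ≤ 2`, never reaches `2`; this matches the
      -- `False` cases of `Tangent`.
      have : 0 < a / r' := by positivity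
      have : a / r' < 1 := (div_lt_one hr').2 hlt
      nlinarith
  | coball c r hr =>
    obtain ⟨hlt, h⟩ := touchesAt_coball_iff.1 h
    cases D' with
    | ball c' r' hr' =>
      rw [touchesAt_ball_iff] at h'
      simp only [GDisc.Tangent, GDisc.relCurvature]
      rw [h, h', ← hadef, mul_comm (1 - a / r)]
      refine hcoball r' r hr' hlt hr _ dist_nonneg ?_
      rw [dist_comm, hdist]; ring
    | half n' t' hn' =>
      simp only [GDisc.Tangent, GDisc.relCurvature, false_iff]
      have : 0 < a / r := by positivity
      have : a / r < 1 := (div_lt_one hr).2 hlt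
      nlinarith
    | coball c' r' hr' =>
      obtain ⟨hlt', h'⟩ := touchesAt_coball_iff.1 h'
      simp only [GDisc.Tangent, GDisc.relCurvature, false_iff]
      have h1 : 0 < a / r := by positivity
      have h2 : a / r < 1 := (div_lt_one hr).2 hlt
      have h3 : 0 < a / r' := by positivity
      have h4 : a / r' < 1 := (div_lt_one hr').2 hlt'
      have h5 : (1 - a / r) * (1 - a / r') < 1 := by nlinarith
      have h6 : 0 < (1 - a / r) * (1 - a / r') := mul_pos (by linarith) (by linarith)
      nlinarith

/-! ### Spinors: tangency as a symplectic product. -/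

/-- The spinor of a disc touching `C₀` at angle `θ`: it has argument `θ / 2`, and its squared length
is the relative curvature of the disc. -/
noncomputable def spinor (C₀ : ProperCircle) (D : GDisc) (θ : ℝ) : ℂ :=
  (√(D.relCurvature C₀.radius) : ℝ) * Complex.exp ((θ / 2 : ℝ) * Complex.I)

/-- The half angles in the spinors turn `1 - cos x = 2 sin² (x / 2)` into the square of the
symplectic product. -/
lemma TouchesAt.tangent_iff_cross_sq (h : C₀.TouchesAt D θ) (h' : C₀.TouchesAt D' θ') :
    D.Tangent D' ↔ cross (C₀.spinor D θ) (C₀.spinor D' θ') ^ 2 = 1 := by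
  rw [h.tangent_iff h', spinor, spinor, cross_mul_exp, mul_pow, mul_pow,
    Real.sq_sqrt h.relCurvature_pos.le, Real.sq_sqrt h'.relCurvature_pos.le, Real.sin_sq_eq_half_sub,
    show 2 * (θ' / 2 - θ / 2) = θ' - θ by ring]
  constructor <;> intro h <;> linarith

/-- Half the angle difference lies in `(0, π)`, where the sine is positive, so only the root `+1`
survives. -/
lemma TouchesAt.tangent_iff_cross (h : C₀.TouchesAt D θ) (h' : C₀.TouchesAt D' θ')
    (hlt : θ < θ') (hlt' : θ' < θ + 2 * Real.pi) :
    D.Tangent D' ↔ cross (C₀.spinor D θ) (C₀.spinor D' θ') = 1 := by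
  rw [h.tangent_iff_cross_sq h']
  have : 0 < cross (C₀.spinor D θ) (C₀.spinor D' θ') := by
    rw [spinor, spinor, cross_mul_exp]
    have := Real.sqrt_pos.2 h.relCurvature_pos
    have := Real.sqrt_pos.2 h'.relCurvature_pos
    have := Real.sin_pos_of_pos_of_lt_pi (x := θ' / 2 - θ / 2) (by linarith) (by linarith)
    positivity
  exact pow_eq_one_iff_of_nonneg this.le two_ne_zero

lemma TouchesAt.lt_of_cross_pos (h : C₀.TouchesAt D θ) (h' : C₀.TouchesAt D' θ')
    (hlt : θ < θ' + 2 * Real.pi) (hpos : 0 < cross (C₀.spinor D θ) (C₀.spinor D' θ')) :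
    θ < θ' := by
  have := _root_.lt_of_cross_pos (Real.sqrt_pos.2 h.relCurvature_pos)
    (Real.sqrt_pos.2 h'.relCurvature_pos) (by linarith) hpos
  linarith

/-- A vector on the left of the spinor of a disc is the spinor of a disc. -/
lemma exists_touchesAt_spinor_eq (h : C₀.TouchesAt D θ) {η : ℂ}
    (hη : 0 < cross (C₀.spinor D θ) η) :
    ∃ S φ, C₀.TouchesAt S φ ∧ C₀.spinor S φ = η ∧ θ < φ ∧ φ < θ + 2 * Real.pi := by
  obtain ⟨b, β, hb, h1, h2, rfl⟩ :=
    exists_polar_of_cross_pos (Real.sqrt_pos.2 h.relCurvature_pos) hη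
  obtain ⟨S, hS, hk⟩ := C₀.exists_touchesAt (2 * β) (pow_pos hb 2)
  refine ⟨S, 2 * β, hS, ?_, by linarith, by linarith⟩
  rw [spinor, hk, Real.sqrt_sq hb.le]
  congr 4
  ring

lemma TouchesAt.add_two_pi (h : C₀.TouchesAt D θ) : C₀.TouchesAt D (θ + 2 * Real.pi) := by
  refine ⟨h.1, ?_⟩
  have : C₀.point (θ + 2 * Real.pi) = C₀.point θ := by
    simp only [point]
    push_cast
    rw [add_mul, Complex.exp_periodic]
  rw [this]
  exact h.2

/-- Spinors are defined only up to sign by the disc; this sign change is what forces the third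
spinor of a configuration. -/
lemma spinor_add_two_pi : C₀.spinor D (θ + 2 * Real.pi) = -C₀.spinor D θ := by
  simp only [spinor]
  rw [show ((((θ + 2 * Real.pi) / 2 : ℝ)) : ℂ) * Complex.I =
    ((θ / 2 : ℝ) : ℂ) * Complex.I + Real.pi * Complex.I by push_cast; ring, Complex.exp_add,
    Complex.exp_pi_mul_I]
  ring

end ProperCircle

/-! ### The base curve as a fixed point, and its Farey chords. -/

/-- Continuous curves from `(0, 0)` to `(1, 1)`. -/
abbrev EndpointCurve : Type := {g : C(unitInterval, ℝ × ℝ) // g 0 = (0, 0) ∧ g 1 = (1, 1)}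

/-- The Apollonian curve in the coordinates given by the spinors of the two discs, parametrized by the slope. -/
lemma exists_base_curve : ∃ g : ℝ → ℝ × ℝ, Continuous g ∧ g 0 = (0, 0) ∧ g 1 = (1, 1) ∧
    (∀ s ∈ Set.Icc (0 : ℝ) 1, g (s / (1 + s)) = (((g s).1 + (g s).2) / 3, (g s).2 / 3)) ∧
    ∀ s ∈ Set.Icc (0 : ℝ) 1,
      g (1 / (2 - s)) = ((2 + (g s).1) / 3, (1 + (g s).1 + (g s).2) / 3) := by
  have hmax (s : ℝ) : 0 < max s (1 - s) := by
    rcases le_total s (1 - s) with h | h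
    · rw [max_eq_right h]; linarith
    · rw [max_eq_left h]; linarith
  have hL (s : unitInterval) : (s : ℝ) / max (s : ℝ) (1 - s) ∈ unitInterval :=
    ⟨div_nonneg s.2.1 (hmax s).le, (div_le_one (hmax s)).2 (le_max_left _ _)⟩
  -- `L` inverts `s ↦ s / (1 + s)` on `[0, 1/2]` and is constantly `1` afterwards; its mirror image
  -- `R` is `0` up to `1/2` and then inverts `s ↦ 1 / (2 - s)`.
  let L : C(unitInterval, unitInterval) :=
    ⟨fun s => ⟨(s : ℝ) / max (s : ℝ) (1 - s), hL s⟩, by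
      refine Continuous.subtype_mk (Continuous.div (by fun_prop) (by fun_prop) ?_) _
      exact fun s => (hmax s).ne'⟩
  let R : C(unitInterval, unitInterval) :=
    ⟨fun s => unitInterval.symm (L (unitInterval.symm s)), by fun_prop⟩
  have hL0 : L 0 = 0 := Subtype.ext (by simp [L])
  have hL1 : L 1 = 1 := Subtype.ext (by simp [L])
  have hR0 : R 0 = 0 := by simp [R, hL1]
  have hR1 : R 1 = 1 := by simp [R, hL0]
  have hLhalf (s : unitInterval) (hs : (1 : ℝ) / 2 ≤ s) : L s = 1 := by
    apply Subtype.ext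
    have : (s : ℝ) ≠ 0 := by linarith
    simp only [L, ContinuousMap.coe_mk, max_eq_left (show 1 - (s : ℝ) ≤ s by linarith)]
    simp [this]
  have hRhalf (s : unitInterval) (hs : (s : ℝ) ≤ 1 / 2) : R s = 0 := by
    simp only [R, ContinuousMap.coe_mk]
    rw [hLhalf _ (by simp; linarith)]
    simp
  have hclosed : IsClosed {g : C(unitInterval, ℝ × ℝ) | g 0 = (0, 0) ∧ g 1 = (1, 1)} :=
    (isClosed_eq (by fun_prop) continuous_const).inter (isClosed_eq (by fun_prop) continuous_const)
  have : CompleteSpace EndpointCurve := hclosed.completeSpace_coe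
  have : Nonempty EndpointCurve := ⟨⟨⟨fun s => (s, s), by fun_prop⟩, by simp, by simp⟩⟩
  -- One formula for both halves, which avoids gluing. With `R = 0` it is a third of the curve read
  -- in the basis `u, u + w`; with `L = 1` it is a third of the curve in the basis `u + w, w`, moved
  -- to the successor point `(2/3, 1/3)`.
  let T : EndpointCurve → EndpointCurve := fun g => ⟨⟨fun s =>
      (((g.1 (L s)).1 + (g.1 (L s)).2 + (g.1 (R s)).1) / 3,
        ((g.1 (L s)).2 + (g.1 (R s)).1 + (g.1 (R s)).2) / 3), by fun_prop⟩, by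
      simp [hL0, hR0, g.2.1], by
      simp only [ContinuousMap.coe_mk, hL1, hR1, g.2.2]; norm_num⟩
  have hT : ContractingWith (2 / 3) T := by
    refine ⟨by rw [← NNReal.coe_lt_coe]; norm_num, LipschitzWith.of_dist_le_mul fun g h => ?_⟩
    have key (s : unitInterval) : |(g.1 s).1 - (h.1 s).1| ≤ dist g h ∧
        |(g.1 s).2 - (h.1 s).2| ≤ dist g h := by
      have := ContinuousMap.dist_apply_le_dist (f := g.1) (g := h.1) s
      rw [Prod.dist_eq, max_le_iff] at this
      exact this
    have h0 : g.1 0 = h.1 0 := g.2.1.trans h.2.1.symm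
    have h1 : g.1 1 = h.1 1 := g.2.2.trans h.2.2.symm
    have hpos : 0 ≤ dist g h := dist_nonneg
    rw [Subtype.dist_eq, ContinuousMap.dist_le (by positivity)]
    intro s
    rw [Prod.dist_eq]
    simp only [T, ContinuousMap.coe_mk, Real.dist_eq, NNReal.coe_div, NNReal.coe_ofNat]
    -- On each half one of the two terms is a common endpoint and cancels. At most two coordinate
    -- differences remain, each divided by `3`, whence the factor `2/3`.
    rcases le_total (s : ℝ) (1 / 2) with hs | hs
    · rw [hRhalf s hs, h0]
      obtain ⟨k1, k2⟩ := key (L s)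
      rw [abs_le] at k1 k2
      refine max_le ?_ ?_ <;> rw [abs_le] <;> constructor <;> linarith
    · rw [hLhalf s hs, h1]
      obtain ⟨k1, k2⟩ := key (R s)
      rw [abs_le] at k1 k2
      refine max_le ?_ ?_ <;> rw [abs_le] <;> constructor <;> linarith
  obtain ⟨g, hg⟩ : ∃ g : EndpointCurve, T g = g := ⟨_, hT.fixedPoint_isFixedPt⟩
  have hfix (s : unitInterval) : g.1 s =
      (((g.1 (L s)).1 + (g.1 (L s)).2 + (g.1 (R s)).1) / 3,
        ((g.1 (L s)).2 + (g.1 (R s)).1 + (g.1 (R s)).2) / 3) := by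
    conv_lhs => rw [← hg]
    rfl
  refine ⟨Set.IccExtend zero_le_one g.1, g.1.continuous.Icc_extend', ?_, ?_, ?_, ?_⟩
  · rw [Set.IccExtend_left]; exact g.2.1
  · rw [Set.IccExtend_right]; exact g.2.2
  · intro s hs
    have hm : s / (1 + s) ∈ Set.Icc (0 : ℝ) 1 :=
      ⟨div_nonneg hs.1 (by linarith [hs.1]), (div_le_one (by linarith [hs.1])).2 (by linarith)⟩
    have hle : s / (1 + s) ≤ 1 / 2 := by
      rw [div_le_div_iff₀ (by linarith [hs.1]) (by norm_num)]; linarith [hs.2]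
    rw [Set.IccExtend_of_mem _ _ hs, Set.IccExtend_of_mem _ _ hm, hfix ⟨_, hm⟩,
      hRhalf ⟨_, hm⟩ hle, g.2.1]
    have : L ⟨_, hm⟩ = ⟨s, hs⟩ := by
      apply Subtype.ext
      simp only [L, ContinuousMap.coe_mk]
      rw [max_eq_right (by linarith)]
      have : 1 + s ≠ 0 := by linarith [hs.1]
      field_simp
      ring
    rw [this]
    simp
  · intro s hs
    have h2 : 0 < 2 - s := by linarith [hs.2]
    have hm : 1 / (2 - s) ∈ Set.Icc (0 : ℝ) 1 :=
      ⟨by positivity, (div_le_one h2).2 (by linarith [hs.2])⟩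
    have hle : 1 / 2 ≤ 1 / (2 - s) := by
      rw [div_le_div_iff₀ (by norm_num) h2]; linarith [hs.1]
    rw [Set.IccExtend_of_mem _ _ hs, Set.IccExtend_of_mem _ _ hm, hfix ⟨_, hm⟩,
      hLhalf ⟨_, hm⟩ hle, g.2.2]
    have : R ⟨_, hm⟩ = ⟨s, hs⟩ := by
      apply Subtype.ext
      simp only [R, L, ContinuousMap.coe_mk, unitInterval.coe_symm_eq]
      rw [max_eq_right (by linarith)]
      field_simp
      ring
    rw [this]
    ext <;> simp <;> ring

/-- The Apollonian curve in the coordinates given by the spinors of the two discs. -/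
noncomputable def baseCurve : ℝ → ℝ × ℝ := exists_base_curve.choose

lemma continuous_baseCurve : Continuous baseCurve := exists_base_curve.choose_spec.1

lemma baseCurve_zero : baseCurve 0 = (0, 0) := exists_base_curve.choose_spec.2.1

lemma baseCurve_one : baseCurve 1 = (1, 1) := exists_base_curve.choose_spec.2.2.1

lemma baseCurve_left {s : ℝ} (hs : s ∈ Set.Icc (0 : ℝ) 1) : baseCurve (s / (1 + s)) =
    (((baseCurve s).1 + (baseCurve s).2) / 3, (baseCurve s).2 / 3) :=
  exists_base_curve.choose_spec.2.2.2.1 s hs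

lemma baseCurve_right {s : ℝ} (hs : s ∈ Set.Icc (0 : ℝ) 1) : baseCurve (1 / (2 - s)) =
    ((2 + (baseCurve s).1) / 3, (1 + (baseCurve s).1 + (baseCurve s).2) / 3) :=
  exists_base_curve.choose_spec.2.2.2.2 s hs

/-- The chord of the base curve between two Farey neighbours is a multiple of their mediant. -/
lemma baseCurve_chord (n : ℕ) : ∀ p q p' q' : ℕ, p + q + p' + q' = n → p * q' = p' * q + 1 →
    ∃ t : ℝ, (baseCurve ((q' : ℝ) / (p' + q'))).1 - (baseCurve ((q : ℝ) / (p + q))).1 = t * (p + p') ∧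
      (baseCurve ((q' : ℝ) / (p' + q'))).2 - (baseCurve ((q : ℝ) / (p + q))).2 = t * (q + q') := by
  induction n using Nat.strong_induction_on with
  | _ n ih =>
    intro p q p' q' hn hdet
    have hp : 0 < p := Nat.pos_of_ne_zero (by rintro rfl; simp at hdet)
    have hq' : 0 < q' := Nat.pos_of_ne_zero (by rintro rfl; simp at hdet)
    have hmem (a b : ℕ) : (b : ℝ) / (a + b) ∈ Set.Icc (0 : ℝ) 1 :=
      ⟨by positivity, div_le_one_of_le₀ (by linarith [(Nat.cast_nonneg a : (0 : ℝ) ≤ a)])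
        (by positivity)⟩
    have hleft (a b : ℕ) (h : 0 < a + b) : (b : ℝ) / (((a + b : ℕ) : ℝ) + b) =
        (b : ℝ) / (a + b) / (1 + (b : ℝ) / (a + b)) := by
      have : (0 : ℝ) < a + b := by exact_mod_cast h
      push_cast
      field_simp
    have hright (a b : ℕ) (h : 0 < a + b) : ((a + b : ℕ) : ℝ) / (a + ((a + b : ℕ) : ℝ)) =
        1 / (2 - (b : ℝ) / (a + b)) := by
      have : (0 : ℝ) < a + b := by exact_mod_cast h
      have ha : (0 : ℝ) ≤ a := Nat.cast_nonneg a
      have : (2 : ℝ) * (a + b) - b ≠ 0 := by linarith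
      have : (a : ℝ) + (a + b) ≠ 0 := by linarith
      push_cast
      rw [show (2 : ℝ) - b / (a + b) = (2 * (a + b) - b) / (a + b) by field_simp, one_div_div,
        div_eq_div_iff (by assumption) (by assumption)]
      ring
    -- Both neighbours lie in the left half: rewriting `p u + q w` as `(p - q) u + q (u + w)` keeps
    -- the determinant and lowers the sum of the coefficients.
    by_cases h1 : q ≤ p ∧ q' ≤ p'
    · obtain ⟨a, rfl⟩ := Nat.exists_eq_add_of_le h1.1
      obtain ⟨a', rfl⟩ := Nat.exists_eq_add_of_le h1.2
      obtain ⟨t, h3, h4⟩ := ih (a + q + a' + q') (by omega) a q a' q' rfl (by nlinarith)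
      rw [add_comm q, add_comm q', hleft a q (by omega), hleft a' q' (by omega),
        baseCurve_left (hmem a q), baseCurve_left (hmem a' q')]
      refine ⟨t / 3, ?_, ?_⟩ <;> push_cast <;> linarith
    by_cases h2 : p ≤ q ∧ p' ≤ q'
    · obtain ⟨b, rfl⟩ := Nat.exists_eq_add_of_le h2.1
      obtain ⟨b', rfl⟩ := Nat.exists_eq_add_of_le h2.2
      obtain ⟨t, h3, h4⟩ := ih (p + b + p' + b') (by omega) p b p' b' rfl (by nlinarith)
      rw [hright p b (by omega), hright p' b' (by omega),
        baseCurve_right (hmem p b), baseCurve_right (hmem p' b')]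
      refine ⟨t / 3, ?_, ?_⟩ <;> push_cast <;> linarith
    -- Neighbours strictly on either side of slope `1/2`: then `p q' ≥ (q + 1)(p' + 1)`, so
    -- determinant `1` leaves only the initial pair.
    have h3 : q + 1 ≤ p ∧ p' + 1 ≤ q' := by
      by_contra h
      have : p ≤ q ∧ q' ≤ p' := by omega
      have := Nat.mul_le_mul this.1 this.2
      nlinarith
    have h4 := Nat.mul_le_mul h3.1 h3.2
    have hq : q = 0 := by nlinarith
    have hp' : p' = 0 := by nlinarith
    subst hq hp'
    have : p = 1 := Nat.eq_one_of_mul_eq_one_right (by simpa using hdet)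
    have : q' = 1 := Nat.eq_one_of_mul_eq_one_left (by simpa using hdet)
    subst p q'
    refine ⟨1, ?_, ?_⟩ <;> simp [baseCurve_zero, baseCurve_one]

/-! ### Tangent pairs and their Apollonian families. -/

open ProperCircle

/-- Two tangent discs touching `C₀` at angles `θ < θ'` less than a full turn apart. -/
structure TangentPair (C₀ : ProperCircle) (D : GDisc) (θ : ℝ) (D' : GDisc) (θ' : ℝ) : Prop where
  touches_left : C₀.TouchesAt D θ
  touches_right : C₀.TouchesAt D' θ'
  tangent : D.Tangent D'
  lt : θ < θ'
  lt_add : θ' < θ + 2 * Real.pi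

section

variable {C₀ : ProperCircle} {D D' S D₁ D₂ : GDisc} {θ θ' φ θ₁ θ₂ : ℝ}

lemma cross_add_right (u v w : ℂ) : cross u (v + w) = cross u v + cross u w := by
  simp only [cross, Complex.add_re, Complex.add_im]; ring

lemma cross_add_left (u v w : ℂ) : cross (u + v) w = cross u w + cross v w := by
  simp only [cross, Complex.add_re, Complex.add_im]; ring

lemma cross_real_mul_right (r : ℝ) (u w : ℂ) : cross u (r * w) = r * cross u w := by
  simp only [cross, Complex.mul_re, Complex.mul_im, Complex.ofReal_re, Complex.ofReal_im]; ring

lemma cross_real_mul_left (r : ℝ) (u w : ℂ) : cross (r * u) w = r * cross u w := by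
  simp only [cross, Complex.mul_re, Complex.mul_im, Complex.ofReal_re, Complex.ofReal_im]; ring

lemma cross_self_eq_zero (u : ℂ) : cross u u = 0 := by
  simp only [cross]; ring

lemma cross_swap (u w : ℂ) : cross w u = -cross u w := by
  simp only [cross]; ring

/-- Two real multiples of independent vectors are equal only if they vanish. -/
lemma eq_zero_of_real_mul_eq {u w : ℂ} (h : cross u w ≠ 0) {a b : ℝ}
    (hab : (a : ℂ) * u = b * w) : a = 0 ∧ b = 0 := by
  have h1 := congrArg (cross u) hab
  have h2 := congrArg (fun z => cross z w) hab
  simp only [cross_real_mul_right, cross_real_mul_left, cross_self_eq_zero, mul_zero] at h1 h2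
  exact ⟨(mul_eq_zero.1 h2).resolve_right h, (mul_eq_zero.1 h1.symm).resolve_right h⟩

namespace TangentPair

lemma cross_eq_one (h : TangentPair C₀ D θ D' θ') :
    cross (C₀.spinor D θ) (C₀.spinor D' θ') = 1 :=
  (h.touches_left.tangent_iff_cross h.touches_right h.lt h.lt_add).1 h.tangent

lemma of_isSuccessor_left (h : TangentPair C₀ D θ D' θ') (hS : IsSuccessor C₀ D θ D' θ' S φ) :
    TangentPair C₀ D θ S φ :=
  ⟨h.touches_left, hS.touches, hS.tangent_left.symm, hS.left_lt, hS.lt_right.trans h.lt_add⟩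

lemma of_isSuccessor_right (h : TangentPair C₀ D θ D' θ') (hS : IsSuccessor C₀ D θ D' θ' S φ) :
    TangentPair C₀ S φ D' θ' :=
  ⟨hS.touches, h.touches_right, hS.tangent_right, hS.lt_right, by linarith [h.lt_add, hS.left_lt]⟩

/-- The spinor of the successor is the sum of the spinors of the pair. -/
lemma spinor_successor (h : TangentPair C₀ D θ D' θ') (hS : IsSuccessor C₀ D θ D' θ' S φ) :
    C₀.spinor S φ = C₀.spinor D θ + C₀.spinor D' θ' := by
  have h1 := (h.of_isSuccessor_left hS).cross_eq_one
  have h2 := (h.of_isSuccessor_right hS).cross_eq_one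
  -- The coordinates of the successor's spinor are its symplectic products with the pair, and both
  -- equal `1` by tangency.
  rw [eq_smul_add_smul_of_cross_eq_one h.cross_eq_one (C₀.spinor S φ), h1, h2]
  simp

lemma exists_successor (h : TangentPair C₀ D θ D' θ') :
    ∃ S φ, IsSuccessor C₀ D θ D' θ' S φ := by
  have h1 : cross (C₀.spinor D θ) (C₀.spinor D θ + C₀.spinor D' θ') = 1 := by
    rw [cross_add_right, cross_self_eq_zero, h.cross_eq_one, zero_add]
  have h2 : cross (C₀.spinor D θ + C₀.spinor D' θ') (C₀.spinor D' θ') = 1 := by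
    rw [cross_add_left, cross_self_eq_zero, h.cross_eq_one, add_zero]
  obtain ⟨S, φ, hS, hsp, hlt, hlt'⟩ :=
    exists_touchesAt_spinor_eq h.touches_left (by rw [h1]; norm_num)
  rw [← hsp] at h1 h2
  have hlt2 : φ < θ' := hS.lt_of_cross_pos h.touches_right (by linarith [h.lt])
    (by rw [h2]; norm_num)
  exact ⟨S, φ, hlt, hlt2, hS,
    ((h.touches_left.tangent_iff_cross hS hlt hlt').2 h1).symm,
    (hS.tangent_iff_cross h.touches_right hlt2 (by linarith [h.lt_add])).2 h2⟩

/-- The members of the Apollonian family touch `C₀` within the given arc, and their spinors are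
natural combinations of the two initial ones. -/
lemma mem_family (h : TangentPair C₀ D₁ θ₁ D₂ θ₂) (hD : ApollonianFamily C₀ D₁ θ₁ D₂ θ₂ D θ) :
    C₀.TouchesAt D θ ∧ θ₁ ≤ θ ∧ θ ≤ θ₂ ∧
      ∃ p q : ℕ, C₀.spinor D θ = p * C₀.spinor D₁ θ₁ + q * C₀.spinor D₂ θ₂ := by
  induction hD with
  | left => exact ⟨h.touches_left, le_rfl, h.lt.le, 1, 0, by simp⟩
  | right => exact ⟨h.touches_right, h.lt.le, le_rfl, 0, 1, by simp⟩
  | successor hD hD' htan hS ih ih' =>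
    obtain ⟨ht, h1, h2, p, q, hsp⟩ := ih
    obtain ⟨ht', h1', h2', p', q', hsp'⟩ := ih'
    have hlt := hS.left_lt.trans hS.lt_right
    have hpair : TangentPair C₀ _ _ _ _ := ⟨ht, ht', htan, hlt, by linarith [h.lt_add]⟩
    refine ⟨hS.touches, h1.trans hS.left_lt.le, hS.lt_right.le.trans h2', p + p', q + q', ?_⟩
    rw [hpair.spinor_successor hS, hsp, hsp']
    push_cast
    ring

lemma of_mem_family (h : TangentPair C₀ D₁ θ₁ D₂ θ₂) (hD : ApollonianFamily C₀ D₁ θ₁ D₂ θ₂ D θ)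
    (hD' : ApollonianFamily C₀ D₁ θ₁ D₂ θ₂ D' θ') (htan : D.Tangent D') (hlt : θ < θ') :
    TangentPair C₀ D θ D' θ' :=
  ⟨(h.mem_family hD).1, (h.mem_family hD').1, htan, hlt, by
    linarith [(h.mem_family hD).2.1, (h.mem_family hD').2.2.1, h.lt_add]⟩

end TangentPair

lemma ApollonianFamily.trans {E F : GDisc} {ε ψ : ℝ} (hE : ApollonianFamily C₀ D₁ θ₁ D₂ θ₂ E ε)
    (hF : ApollonianFamily C₀ D₁ θ₁ D₂ θ₂ F ψ) (hD : ApollonianFamily C₀ E ε F ψ D θ) :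
    ApollonianFamily C₀ D₁ θ₁ D₂ θ₂ D θ := by
  induction hD with
  | left => exact hE
  | right => exact hF
  | successor _ _ htan hS ih ih' => exact .successor ih ih' htan hS

/-- Every rational direction between the spinors of the pair is that of a member of the family. -/
lemma TangentPair.exists_mem_family (n : ℕ) : ∀ (p q : ℕ) (D₁ D₂ : GDisc) (θ₁ θ₂ : ℝ),
    p + q = n → 0 < n → TangentPair C₀ D₁ θ₁ D₂ θ₂ →
    ∃ D θ, ∃ c : ℝ, 0 < c ∧ ApollonianFamily C₀ D₁ θ₁ D₂ θ₂ D θ ∧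
      C₀.spinor D θ = c * (p * C₀.spinor D₁ θ₁ + q * C₀.spinor D₂ θ₂) := by
  induction n using Nat.strong_induction_on with
  | _ n ih =>
    intro p q D₁ D₂ θ₁ θ₂ hn hpos h
    rcases Nat.eq_zero_or_pos p with rfl | hp
    · have hq : (0 : ℝ) < q := by exact_mod_cast (by omega : 0 < q)
      refine ⟨D₂, θ₂, (q : ℝ)⁻¹, by positivity, .right, ?_⟩
      have : (q : ℂ) ≠ 0 := by exact_mod_cast hq.ne'
      push_cast
      field_simp
      ring
    rcases Nat.eq_zero_or_pos q with rfl | hq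
    · have hp : (0 : ℝ) < p := by exact_mod_cast hp
      refine ⟨D₁, θ₁, (p : ℝ)⁻¹, by positivity, .left, ?_⟩
      have : (p : ℂ) ≠ 0 := by exact_mod_cast hp.ne'
      push_cast
      field_simp
      ring
    obtain ⟨S, φ, hS⟩ := h.exists_successor
    have hSm : ApollonianFamily C₀ D₁ θ₁ D₂ θ₂ S φ := .successor .left .right h.tangent hS
    -- Subtractive Euclidean algorithm, replacing one spinor of the pair by their sum; `c` absorbs
    -- the common factor of `p` and `q`.
    rcases le_total q p with hle | hle
    · obtain ⟨a, rfl⟩ := Nat.exists_eq_add_of_le hle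
      obtain ⟨D, θ, c, hc, hD, hsp⟩ := ih (a + q) (by omega) a q D₁ S θ₁ φ rfl (by omega)
        (h.of_isSuccessor_left hS)
      refine ⟨D, θ, c, hc, .trans .left hSm hD, ?_⟩
      rw [hsp, h.spinor_successor hS]
      push_cast
      ring
    · obtain ⟨b, rfl⟩ := Nat.exists_eq_add_of_le hle
      obtain ⟨D, θ, c, hc, hD, hsp⟩ := ih (p + b) (by omega) p b S D₂ φ θ₂ rfl (by omega)
        (h.of_isSuccessor_right hS)
      refine ⟨D, θ, c, hc, .trans hSm .right hD, ?_⟩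
      rw [hsp, h.spinor_successor hS]
      push_cast
      ring

/-- The unit spinor at angle `θ`. -/
noncomputable def halfAngle (θ : ℝ) : ℂ := Complex.exp ((θ / 2 : ℝ) * Complex.I)

lemma spinor_eq_mul_halfAngle (h : C₀.TouchesAt D θ) :
    ∃ ρ : ℝ, 0 < ρ ∧ C₀.spinor D θ = ρ * halfAngle θ :=
  ⟨_, Real.sqrt_pos.2 h.relCurvature_pos, rfl⟩

lemma cross_halfAngle (α β : ℝ) : cross (halfAngle α) (halfAngle β) = Real.sin ((β - α) / 2) := by
  have := cross_mul_exp 1 1 (α / 2) (β / 2)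
  simp only [Complex.ofReal_one, one_mul] at this
  rw [halfAngle, halfAngle, this]
  ring_nf

namespace TangentPair

lemma cross_left_nonneg (h : TangentPair C₀ D₁ θ₁ D₂ θ₂) (hθ : θ ∈ Set.Icc θ₁ θ₂) :
    0 ≤ cross (C₀.spinor D₁ θ₁) (halfAngle θ) := by
  obtain ⟨ρ, hρ, e⟩ := spinor_eq_mul_halfAngle h.touches_left
  rw [e, cross_real_mul_left, cross_halfAngle]
  exact mul_nonneg hρ.le (Real.sin_nonneg_of_nonneg_of_le_pi (by linarith [hθ.1])
    (by linarith [hθ.2, h.lt_add]))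

lemma cross_right_nonneg (h : TangentPair C₀ D₁ θ₁ D₂ θ₂) (hθ : θ ∈ Set.Icc θ₁ θ₂) :
    0 ≤ cross (halfAngle θ) (C₀.spinor D₂ θ₂) := by
  obtain ⟨ρ, hρ, e⟩ := spinor_eq_mul_halfAngle h.touches_right
  rw [e, cross_real_mul_right, cross_halfAngle]
  exact mul_nonneg hρ.le (Real.sin_nonneg_of_nonneg_of_le_pi (by linarith [hθ.2])
    (by linarith [hθ.1, h.lt_add]))

lemma cross_add_cross_pos (h : TangentPair C₀ D₁ θ₁ D₂ θ₂) (hθ : θ ∈ Set.Icc θ₁ θ₂) :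
    0 < cross (halfAngle θ) (C₀.spinor D₂ θ₂) + cross (C₀.spinor D₁ θ₁) (halfAngle θ) := by
  have h1 := h.cross_left_nonneg hθ
  have h2 := h.cross_right_nonneg hθ
  refine lt_of_le_of_ne (by linarith) fun h0 => ?_
  have e1 : cross (C₀.spinor D₁ θ₁) (halfAngle θ) = 0 := by linarith
  have e2 : cross (halfAngle θ) (C₀.spinor D₂ θ₂) = 0 := by linarith
  have := eq_smul_add_smul_of_cross_eq_one h.cross_eq_one (halfAngle θ)
  rw [e1, e2] at this
  have hne : halfAngle θ ≠ 0 := Complex.exp_ne_zero _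
  simp [hne] at this

/-- The angles of the members of the Apollonian family are dense. -/
lemma exists_mem_family_between (h : TangentPair C₀ D₁ θ₁ D₂ θ₂) {α β : ℝ} (hα : θ₁ ≤ α)
    (hαβ : α < β) (hβ : β ≤ θ₂) :
    ∃ D θ, ApollonianFamily C₀ D₁ θ₁ D₂ θ₂ D θ ∧ α < θ ∧ θ < β := by
  set u := C₀.spinor D₁ θ₁
  set w := C₀.spinor D₂ θ₂
  have hmα : α ∈ Set.Icc θ₁ θ₂ := ⟨hα, hαβ.le.trans hβ⟩
  have hmβ : β ∈ Set.Icc θ₁ θ₂ := ⟨hα.trans hαβ.le, hβ⟩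
  have huw : cross u w = 1 := h.cross_eq_one
  set a := cross (halfAngle α) w with ha
  set b := cross u (halfAngle α) with hb
  set a' := cross (halfAngle β) w with ha'
  set b' := cross u (halfAngle β) with hb'
  have eα : halfAngle α = a * u + b * w := eq_smul_add_smul_of_cross_eq_one huw _
  have eβ : halfAngle β = a' * u + b' * w := eq_smul_add_smul_of_cross_eq_one huw _
  have hs : 0 < a + b := h.cross_add_cross_pos hmα
  have hs' : 0 < a' + b' := h.cross_add_cross_pos hmβ
  have hb0 : 0 ≤ b := h.cross_left_nonneg hmα
  have ha0' : 0 ≤ a' := h.cross_right_nonneg hmβ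
  have hcomb (x y x' y' : ℝ) : cross (x * u + y * w) (x' * u + y' * w) = x * y' - y * x' := by
    simp only [cross_add_left, cross_add_right, cross_real_mul_left, cross_real_mul_right,
      cross_self_eq_zero, cross_swap u w, huw]
    ring
  have hdet : 0 < a * b' - b * a' := by
    rw [← hcomb, ← eα, ← eβ, cross_halfAngle]
    exact Real.sin_pos_of_pos_of_lt_pi (by linarith) (by linarith [h.lt_add])
  -- The slope `b / (a + b)` increases with the angle along the arc, so a rational slope in between
  -- gives a member in between.
  obtain ⟨r, hr1, hr2⟩ := exists_rat_btwn (show b / (a + b) < b' / (a' + b') by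
    rw [div_lt_div_iff₀ hs hs']; nlinarith)
  have hr0 : (0 : ℝ) < r := lt_of_le_of_lt (div_nonneg hb0 hs.le) hr1
  have hr1' : (r : ℝ) < 1 := lt_of_lt_of_le hr2 ((div_le_one hs').2 (by linarith))
  obtain ⟨q, N, hN, hqN, hr⟩ : ∃ q N : ℕ, 0 < N ∧ q ≤ N ∧ (r : ℝ) = q / N := by
    have hr0 : 0 < r := by exact_mod_cast hr0
    have hnum : 0 < r.num := Rat.num_pos.2 hr0
    have hre : (r : ℝ) = (r.num.toNat : ℝ) / r.den := by
      have : ((r.num.toNat : ℤ) : ℝ) = r.num := by rw [Int.toNat_of_nonneg hnum.le]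
      rw [Int.cast_natCast] at this
      rw [this, Rat.cast_def]
    refine ⟨r.num.toNat, r.den, r.pos, ?_, hre⟩
    have hd : (0 : ℝ) < r.den := by exact_mod_cast r.pos
    rw [hre, div_lt_one hd] at hr1'
    exact_mod_cast hr1'.le
  obtain ⟨p, rfl⟩ := Nat.exists_eq_add_of_le' hqN
  obtain ⟨D, θ, c, hc, hD, hsp⟩ := exists_mem_family _ p q _ _ _ _ rfl hN h
  obtain ⟨ht, hθ1, hθ2, -⟩ := h.mem_family hD
  obtain ⟨ρ, hρ, e⟩ := spinor_eq_mul_halfAngle ht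
  have hNr : (0 : ℝ) < p + q := by exact_mod_cast hN
  have hq : (q : ℝ) = r * (p + q) := by
    rw [hr]; push_cast; field_simp
  have hp : (p : ℝ) = (1 - r) * (p + q) := by linarith
  rw [div_lt_iff₀ hs] at hr1
  rw [lt_div_iff₀ hs'] at hr2
  have k1 : 0 < cross (halfAngle α) (halfAngle θ) := by
    have : ρ * cross (halfAngle α) (halfAngle θ) = c * (a * q - b * p) := by
      rw [← cross_real_mul_right, ← e, hsp, cross_real_mul_right, eα]
      exact congrArg _ (hcomb a b p q)
    have h2 : 0 < a * q - b * p := by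
      have : a * q - b * p = (p + q) * (r * (a + b) - b) := by
        linear_combination a * hq - b * hp
      rw [this]
      exact mul_pos hNr (sub_pos.2 hr1)
    nlinarith [mul_pos hc h2]
  have k2 : 0 < cross (halfAngle θ) (halfAngle β) := by
    have : ρ * cross (halfAngle θ) (halfAngle β) = c * (p * b' - q * a') := by
      rw [← cross_real_mul_left, ← e, hsp, cross_real_mul_left, eβ]
      exact congrArg _ (hcomb p q a' b')
    have h2 : 0 < p * b' - q * a' := by
      have : p * b' - q * a' = (p + q) * (b' - r * (a' + b')) := by
        linear_combination b' * hp - a' * hq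
      rw [this]
      exact mul_pos hNr (sub_pos.2 hr2)
    nlinarith [mul_pos hc h2]
  refine ⟨D, θ, hD, ?_, ?_⟩
  · have := lt_of_cross_pos (a := 1) (b := 1) (α := α / 2) (β := θ / 2) one_pos one_pos
      (by linarith [h.lt_add]) (by simpa [halfAngle] using k1)
    linarith
  · have := lt_of_cross_pos (a := 1) (b := 1) (α := θ / 2) (β := β / 2) one_pos one_pos
      (by linarith [h.lt_add]) (by simpa [halfAngle] using k2)
    linarith

end TangentPair

/-! ### Rigidity: the endpoints determine an Apollonian curve. -/

lemma IsApollonianCurve.sub {γ γ' : ℝ → ℂ} (h : IsApollonianCurve C₀ D₁ θ₁ D₂ θ₂ γ)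
    (h' : IsApollonianCurve C₀ D₁ θ₁ D₂ θ₂ γ') :
    IsApollonianCurve C₀ D₁ θ₁ D₂ θ₂ (fun θ => γ θ - γ' θ) := by
  refine ⟨h.1.sub h'.1, fun D θ D' θ' S φ hD hD' ht hS => ?_⟩
  obtain ⟨t, e⟩ := h.2 D θ D' θ' S φ hD hD' ht hS
  obtain ⟨t', e'⟩ := h'.2 D θ D' θ' S φ hD hD' ht hS
  refine ⟨t - t', ?_⟩
  push_cast at e e' ⊢
  linear_combination e - e'

/-- The chord of an Apollonian curve between tangent discs is a multiple of the sum of their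
spinors. -/
lemma IsApollonianCurve.exists_chord {γ : ℝ → ℂ} (h : IsApollonianCurve C₀ D₁ θ₁ D₂ θ₂ γ)
    (hD : ApollonianFamily C₀ D₁ θ₁ D₂ θ₂ D θ) (hD' : ApollonianFamily C₀ D₁ θ₁ D₂ θ₂ D' θ')
    (hp : TangentPair C₀ D θ D' θ') :
    ∃ t : ℝ, γ θ' - γ θ = t * (C₀.spinor D θ + C₀.spinor D' θ') := by
  obtain ⟨S, φ, hS⟩ := hp.exists_successor
  obtain ⟨t, e⟩ := h.2 D θ D' θ' S φ hD hD' hp.tangent hS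
  obtain ⟨ρ, hρ, e'⟩ := spinor_eq_mul_halfAngle hS.touches
  refine ⟨-t / ρ, ?_⟩
  rw [← hp.spinor_successor hS, e', ← neg_sub, e, halfAngle]
  have : (ρ : ℂ) ≠ 0 := by exact_mod_cast hρ.ne'
  push_cast
  field_simp

/-- Being Apollonian is a linear condition, so uniqueness reduces to vanishing endpoints. Zeros
propagate to successors, and the family's angles are dense. -/
lemma IsApollonianCurve.eq_zero {γ : ℝ → ℂ} (h : IsApollonianCurve C₀ D₁ θ₁ D₂ θ₂ γ)
    (hp : TangentPair C₀ D₁ θ₁ D₂ θ₂) (h₁ : γ θ₁ = 0) (h₂ : γ θ₂ = 0) :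
    ∀ θ ∈ Set.Icc θ₁ θ₂, γ θ = 0 := by
  have hfam : ∀ D θ, ApollonianFamily C₀ D₁ θ₁ D₂ θ₂ D θ → γ θ = 0 := by
    intro D θ hD
    induction hD with
    | left => exact h₁
    | right => exact h₂
    | @successor E ε E' ε' S φ hD hD' htan hS ih ih' =>
      have hpair := hp.of_mem_family hD hD' htan (hS.left_lt.trans hS.lt_right)
      have hSm := ApollonianFamily.successor hD hD' htan hS
      obtain ⟨a, ha⟩ := h.exists_chord hD hSm (hpair.of_isSuccessor_left hS)
      obtain ⟨b, hb⟩ := h.exists_chord hSm hD' (hpair.of_isSuccessor_right hS)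
      have hc := hpair.cross_eq_one
      rw [ih, sub_zero, hpair.spinor_successor hS] at ha
      rw [ih', zero_sub, hpair.spinor_successor hS] at hb
      -- With spinors `u, w`, the value at the successor is a multiple of both `2u + w` and `u +
      -- 2w`, whose symplectic product is `3`.
      have hne : cross (C₀.spinor E ε + (C₀.spinor E ε + C₀.spinor E' ε'))
          (C₀.spinor E ε + C₀.spinor E' ε' + C₀.spinor E' ε') ≠ 0 := by
        simp only [cross_add_left, cross_add_right, cross_self_eq_zero, hc,
          cross_swap (C₀.spinor E ε) (C₀.spinor E' ε')]
        norm_num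
      have := (eq_zero_of_real_mul_eq (a := a) (b := -b) hne (by
        push_cast
        linear_combination -hb - ha)).1
      rw [ha, this]
      simp
  intro θ hθ
  by_contra hne
  have hev : ∀ᶠ x in nhdsWithin θ (Set.Icc θ₁ θ₂), γ x ≠ 0 := (h.1 θ hθ).eventually_ne hne
  rw [eventually_nhdsWithin_iff, Metric.eventually_nhds_iff] at hev
  obtain ⟨ε, hε, hev⟩ := hev
  obtain ⟨D, x, hD, hx1, hx2⟩ := hp.exists_mem_family_between
    (α := max θ₁ (θ - ε)) (β := min θ₂ (θ + ε)) (le_max_left _ _) (by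
      rw [max_lt_iff, lt_min_iff, lt_min_iff]
      refine ⟨⟨hp.lt, ?_⟩, ?_, ?_⟩ <;> linarith [hθ.1, hθ.2]) (min_le_left _ _)
  rw [max_lt_iff] at hx1
  rw [lt_min_iff] at hx2
  refine hev (y := x) ?_ ⟨hx1.1.le, hx2.1.le⟩ (hfam D x hD)
  rw [Real.dist_eq, abs_lt]
  constructor <;> linarith

/-! ### Apollonian curves built from the base curve, and their traces. -/

/-- The slope of `z` in the basis `u, w`. -/
noncomputable def slopeIn (u w z : ℂ) : ℝ := cross u z / (cross z w + cross u z)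

/-- The point with coordinates `x` in the basis `u, w`. -/
noncomputable def combo (u w : ℂ) (x : ℝ × ℝ) : ℂ := x.1 * u + x.2 * w

/-- The Apollonian curve that starts at `P`, with end chord `t` times the sum of the spinors. -/
noncomputable def apollonianCurve (u w P : ℂ) (t : ℝ) (θ : ℝ) : ℂ :=
  P + t * combo u w (baseCurve (slopeIn u w (halfAngle θ)))

namespace TangentPair

lemma slopeIn_of_spinor_eq (h : TangentPair C₀ D₁ θ₁ D₂ θ₂) (ht : C₀.TouchesAt D θ) {p q : ℕ}
    (hsp : C₀.spinor D θ = p * C₀.spinor D₁ θ₁ + q * C₀.spinor D₂ θ₂) :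
    slopeIn (C₀.spinor D₁ θ₁) (C₀.spinor D₂ θ₂) (halfAngle θ) = (q : ℝ) / (p + q) := by
  obtain ⟨ρ, hρ, e⟩ := spinor_eq_mul_halfAngle ht
  have hc := h.cross_eq_one
  have h1 : ρ * cross (C₀.spinor D₁ θ₁) (halfAngle θ) = q := by
    rw [← cross_real_mul_right, ← e, hsp, cross_add_right, ← Complex.ofReal_natCast,
      ← Complex.ofReal_natCast, cross_real_mul_right, cross_real_mul_right, cross_self_eq_zero, hc]
    ring
  have h2 : ρ * cross (halfAngle θ) (C₀.spinor D₂ θ₂) = p := by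
    rw [← cross_real_mul_left, ← e, hsp, cross_add_left, ← Complex.ofReal_natCast,
      ← Complex.ofReal_natCast, cross_real_mul_left, cross_real_mul_left, cross_self_eq_zero, hc]
    ring
  rw [slopeIn, ← h1, ← h2, ← mul_add, mul_div_mul_left _ _ hρ.ne']

lemma slopeIn_left (h : TangentPair C₀ D₁ θ₁ D₂ θ₂) :
    slopeIn (C₀.spinor D₁ θ₁) (C₀.spinor D₂ θ₂) (halfAngle θ₁) = 0 := by
  rw [h.slopeIn_of_spinor_eq h.touches_left (p := 1) (q := 0) (by simp)]; simp

lemma slopeIn_right (h : TangentPair C₀ D₁ θ₁ D₂ θ₂) :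
    slopeIn (C₀.spinor D₁ θ₁) (C₀.spinor D₂ θ₂) (halfAngle θ₂) = 1 := by
  rw [h.slopeIn_of_spinor_eq h.touches_right (p := 0) (q := 1) (by simp)]; simp

lemma continuousOn_slopeIn (h : TangentPair C₀ D₁ θ₁ D₂ θ₂) : ContinuousOn
    (fun θ => slopeIn (C₀.spinor D₁ θ₁) (C₀.spinor D₂ θ₂) (halfAngle θ)) (Set.Icc θ₁ θ₂) := by
  have hh : Continuous halfAngle := by unfold halfAngle; fun_prop
  have hre : Continuous fun θ => (halfAngle θ).re := Complex.continuous_re.comp hh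
  have him : Continuous fun θ => (halfAngle θ).im := Complex.continuous_im.comp hh
  refine ContinuousOn.div ?_ ?_ fun θ hθ => (h.cross_add_cross_pos hθ).ne' <;>
    unfold cross <;> fun_prop

/-- This removes the angles from the trace, which becomes an image of the whole of `[0, 1]`. -/
lemma image_slopeIn (h : TangentPair C₀ D₁ θ₁ D₂ θ₂) :
    (fun θ => slopeIn (C₀.spinor D₁ θ₁) (C₀.spinor D₂ θ₂) (halfAngle θ)) '' Set.Icc θ₁ θ₂ =
      Set.Icc 0 1 := by
  apply Set.Subset.antisymm
  · rintro _ ⟨θ, hθ, rfl⟩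
    have h1 := h.cross_left_nonneg hθ
    have h2 := h.cross_right_nonneg hθ
    have h3 := h.cross_add_cross_pos hθ
    exact ⟨div_nonneg h1 h3.le, (div_le_one h3).2 (by linarith)⟩
  · have := intermediate_value_Icc h.lt.le h.continuousOn_slopeIn
    rwa [h.slopeIn_left, h.slopeIn_right] at this

/-- Tangent members `p u + q w` and `p' u + q' w` have `p q' - p' q = 1`, so they are Farey
neighbours and the chord identity of `baseCurve` applies. -/
lemma isApollonianCurve (h : TangentPair C₀ D₁ θ₁ D₂ θ₂) (P : ℂ) (t : ℝ) :
    IsApollonianCurve C₀ D₁ θ₁ D₂ θ₂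
      (apollonianCurve (C₀.spinor D₁ θ₁) (C₀.spinor D₂ θ₂) P t) := by
  constructor
  · have := continuous_baseCurve.comp_continuousOn h.continuousOn_slopeIn
    have h1 := Complex.continuous_ofReal.comp_continuousOn (continuous_fst.comp_continuousOn this)
    have h2 := Complex.continuous_ofReal.comp_continuousOn (continuous_snd.comp_continuousOn this)
    exact continuousOn_const.add (continuousOn_const.mul
      ((h1.mul continuousOn_const).add (h2.mul continuousOn_const)))
  · intro D θ D' θ' S φ hD hD' htan hS
    have hpair := h.of_mem_family hD hD' htan (hS.left_lt.trans hS.lt_right)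
    obtain ⟨ht, -, -, p, q, hsp⟩ := h.mem_family hD
    obtain ⟨ht', -, -, p', q', hsp'⟩ := h.mem_family hD'
    have hdet : p * q' = p' * q + 1 := by
      have hc := hpair.cross_eq_one
      rw [hsp, hsp'] at hc
      simp only [← Complex.ofReal_natCast, cross_add_left, cross_add_right, cross_real_mul_left,
        cross_real_mul_right, cross_self_eq_zero, h.cross_eq_one,
        cross_swap (C₀.spinor D₁ θ₁) (C₀.spinor D₂ θ₂)] at hc
      have : (p : ℝ) * q' = p' * q + 1 := by linarith
      exact_mod_cast this
    obtain ⟨s, hs1, hs2⟩ := baseCurve_chord _ p q p' q' rfl hdet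
    obtain ⟨ρ, hρ, e⟩ := spinor_eq_mul_halfAngle hS.touches
    refine ⟨-(t * s * ρ), ?_⟩
    have key : (-(t * s * ρ) : ℂ) * halfAngle φ = -(t * s) * (C₀.spinor D θ + C₀.spinor D' θ') := by
      rw [← hpair.spinor_successor hS, e]; ring
    rw [halfAngle] at key
    rw [Complex.ofReal_neg, Complex.ofReal_mul, Complex.ofReal_mul, key, hsp, hsp']
    simp only [apollonianCurve, combo]
    rw [h.slopeIn_of_spinor_eq ht hsp, h.slopeIn_of_spinor_eq ht' hsp']
    have hs1' := congrArg Complex.ofReal hs1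
    have hs2' := congrArg Complex.ofReal hs2
    push_cast at hs1' hs2' ⊢
    linear_combination (-t * C₀.spinor D₁ θ₁) * hs1' + (-t * C₀.spinor D₂ θ₂) * hs2'

lemma apollonianCurve_left (h : TangentPair C₀ D₁ θ₁ D₂ θ₂) (P : ℂ) (t : ℝ) :
    apollonianCurve (C₀.spinor D₁ θ₁) (C₀.spinor D₂ θ₂) P t θ₁ = P := by
  simp [apollonianCurve, combo, h.slopeIn_left, baseCurve_zero]

lemma apollonianCurve_right (h : TangentPair C₀ D₁ θ₁ D₂ θ₂) (P : ℂ) (t : ℝ) :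
    apollonianCurve (C₀.spinor D₁ θ₁) (C₀.spinor D₂ θ₂) P t θ₂ =
      P + t * (C₀.spinor D₁ θ₁ + C₀.spinor D₂ θ₂) := by
  simp [apollonianCurve, combo, h.slopeIn_right, baseCurve_one]

end TangentPair

/-- The trace of an Apollonian curve from `P` to `P + u + w`. -/
noncomputable def apollonianArc (P u w : ℂ) : Set ℂ :=
  (fun s => P + combo u w (baseCurve s)) '' Set.Icc 0 1

lemma TangentPair.image_apollonianCurve (h : TangentPair C₀ D₁ θ₁ D₂ θ₂) (P : ℂ) (t : ℝ) :
    apollonianCurve (C₀.spinor D₁ θ₁) (C₀.spinor D₂ θ₂) P t '' Set.Icc θ₁ θ₂ =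
      apollonianArc P (t * C₀.spinor D₁ θ₁) (t * C₀.spinor D₂ θ₂) := by
  rw [apollonianArc, ← h.image_slopeIn, Set.image_image]
  refine Set.image_congr fun θ _ => ?_
  simp only [apollonianCurve, combo]
  ring

/-- The trace of an Apollonian curve is determined by its endpoints and its two spinors. -/
lemma IsApollonianCurve.exists_image_eq {γ : ℝ → ℂ} (h : IsApollonianCurve C₀ D₁ θ₁ D₂ θ₂ γ)
    (hp : TangentPair C₀ D₁ θ₁ D₂ θ₂) :
    ∃ t : ℝ, γ θ₂ - γ θ₁ = t * (C₀.spinor D₁ θ₁ + C₀.spinor D₂ θ₂) ∧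
      γ '' Set.Icc θ₁ θ₂ =
        apollonianArc (γ θ₁) (t * C₀.spinor D₁ θ₁) (t * C₀.spinor D₂ θ₂) := by
  obtain ⟨t, ht⟩ := h.exists_chord .left .right hp
  refine ⟨t, ht, ?_⟩
  rw [← hp.image_apollonianCurve]
  refine Set.image_congr fun θ hθ => ?_
  refine sub_eq_zero.1 ((h.sub (hp.isApollonianCurve (γ θ₁) t)).eq_zero hp ?_ ?_ θ hθ)
  · simp [hp.apollonianCurve_left]
  · rw [hp.apollonianCurve_right, ← ht]; ring

end

/-! ### Apollonian triangles: the boundary in terms of the vertices. -/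

/-- The boundary of the Apollonian triangle with vertices `a, b, c` in clockwise order. -/
noncomputable def apollonianBoundary (a b c : ℂ) : Set ℂ :=
  apollonianArc a ((a + b + c) / 3 - a) (b - (a + b + c) / 3) ∪
    apollonianArc b ((a + b + c) / 3 - b) (c - (a + b + c) / 3) ∪
    apollonianArc c ((a + b + c) / 3 - c) (a - (a + b + c) / 3)

lemma apollonianBoundary_rotate (a b c : ℂ) :
    apollonianBoundary b c a = apollonianBoundary a b c := by
  rw [apollonianBoundary, apollonianBoundary, show b + c + a = a + b + c by ring, Set.union_comm,
    Set.union_assoc]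

namespace IsApollonianConfiguration

variable {C₀ : ProperCircle} {D₁ D₂ D₃ : GDisc} {θ₁ θ₂ θ₃ : ℝ} {γ₁₂ γ₂₃ γ₃₁ : ℝ → ℂ}

/-- The curves of a configuration are determined by its vertices, which are in clockwise order. -/
lemma union_eq_apollonianBoundary
    (h : IsApollonianConfiguration C₀ D₁ D₂ D₃ θ₁ θ₂ θ₃ γ₁₂ γ₂₃ γ₃₁) :
    γ₁₂ '' Set.Icc θ₁ θ₂ ∪ γ₂₃ '' Set.Icc θ₂ θ₃ ∪ γ₃₁ '' Set.Icc θ₃ (θ₁ + 2 * Real.pi) =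
      apollonianBoundary (γ₁₂ θ₁) (γ₂₃ θ₂) (γ₃₁ θ₃) ∧
    cross (γ₂₃ θ₂ - γ₁₂ θ₁) (γ₃₁ θ₃ - γ₁₂ θ₁) ≤ 0 := by
  have p₁₂ : TangentPair C₀ D₁ θ₁ D₂ θ₂ :=
    ⟨h.touches₁, h.touches₂, h.tangent₁₂, h.lt₁₂, by linarith [h.lt₂₃, h.lt₃₁]⟩
  have p₂₃ : TangentPair C₀ D₂ θ₂ D₃ θ₃ :=
    ⟨h.touches₂, h.touches₃, h.tangent₂₃, h.lt₂₃, by linarith [h.lt₁₂, h.lt₃₁]⟩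
  have p₃₁ : TangentPair C₀ D₃ θ₃ D₁ (θ₁ + 2 * Real.pi) :=
    ⟨h.touches₃, h.touches₁.add_two_pi, h.tangent₃₁, h.lt₃₁, by linarith [h.lt₁₂, h.lt₂₃]⟩
  obtain ⟨t, ht, ht'⟩ := h.curve₁₂.exists_image_eq p₁₂
  obtain ⟨s, hs, hs'⟩ := h.curve₂₃.exists_image_eq p₂₃
  obtain ⟨r, hr, hr'⟩ := h.curve₃₁.exists_image_eq p₃₁
  rw [h.vertex₂] at ht
  rw [h.vertex₃] at hs
  rw [h.vertex₁] at hr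
  have c₁₂ := p₁₂.cross_eq_one
  have c₂₃ := p₂₃.cross_eq_one
  have c₃₁ := p₃₁.cross_eq_one
  rw [spinor_add_two_pi] at c₃₁ hr hr'
  set u := C₀.spinor D₁ θ₁
  set w := C₀.spinor D₂ θ₂
  set a := γ₁₂ θ₁
  set b := γ₂₃ θ₂
  set c := γ₃₁ θ₃
  -- Its products with `w` and with `-u`, the spinor of `D₁` after a full turn, are both prescribed.
  have e : C₀.spinor D₃ θ₃ = w - u := by
    have h1 : cross u (C₀.spinor D₃ θ₃) = 1 := by
      rw [← c₃₁]; simp only [cross, Complex.neg_re, Complex.neg_im]; ring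
    have h2 : cross (C₀.spinor D₃ θ₃) w = -1 := by rw [cross_swap w, c₂₃]
    rw [eq_smul_add_smul_of_cross_eq_one c₁₂ (C₀.spinor D₃ θ₃), h1, h2]
    push_cast
    ring
  rw [e] at hs hs' hr hr'
  -- The chords `t (u + w)`, `s (2w - u)`, `r (w - 2u)` add up to zero; these are the coefficients
  -- of `u` and `w`.
  obtain ⟨k1, k2⟩ := eq_zero_of_real_mul_eq (u := u) (w := w) (a := t - s - 2 * r)
    (b := -(t + 2 * s + r)) (by rw [c₁₂]; norm_num) (by
      push_cast
      linear_combination -ht - hs - hr)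
  obtain rfl : s = -t := by linarith
  obtain rfl : r = t := by linarith
  have e1 : (a + b + c) / 3 - a = r * u := by
    push_cast at hs
    linear_combination (2 / 3 : ℂ) * ht + (1 / 3 : ℂ) * hs
  have e2 : b - (a + b + c) / 3 = r * w := by
    push_cast at hs
    linear_combination (1 / 3 : ℂ) * ht - (1 / 3 : ℂ) * hs
  have e3 : (a + b + c) / 3 - c = r * w - r * u := by linear_combination e2 - e1
  constructor
  · rw [ht', hs', hr', apollonianBoundary]
    congr 1
    · congr 1
      · rw [e1, e2]
      · congr 1
        · push_cast
          linear_combination e2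
        · push_cast
          linear_combination e3
    · congr 1
      · linear_combination -e3
      · linear_combination e1
  · have hc : cross (b - a) (c - a) = -3 * cross ((a + b + c) / 3 - a) (b - (a + b + c) / 3) := by
      have hre : ((a + b + c) / 3).re = (a.re + b.re + c.re) / 3 := by simp
      have him : ((a + b + c) / 3).im = (a.im + b.im + c.im) / 3 := by simp
      simp only [cross, Complex.sub_re, Complex.sub_im, hre, him]
      ring
    rw [hc, e1, e2, cross_real_mul_left, cross_real_mul_right, c₁₂]
    nlinarith [mul_self_nonneg r]

end IsApollonianConfiguration

lemma ProperCircle.exists_touchesAt_spinor (C₀ : ProperCircle) {η : ℂ} (hη : η ≠ 0) :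
    ∃ S φ, C₀.TouchesAt S φ ∧ C₀.spinor S φ = η := by
  obtain ⟨S, hS, hk⟩ := C₀.exists_touchesAt (2 * η.arg) (pow_pos (norm_pos_iff.2 hη) 2)
  refine ⟨S, 2 * η.arg, hS, ?_⟩
  rw [spinor, hk, Real.sqrt_sq (norm_nonneg η), mul_div_cancel_left₀ _ two_ne_zero,
    Complex.norm_mul_exp_arg_mul_I]

/-- Points in clockwise order are the vertices of an Apollonian triangle. -/
lemma exists_isApollonianTriangle {a b c : ℂ} (h : cross (b - a) (c - a) < 0) :
    ∃ T, IsApollonianTriangle T {a, b, c} := by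
  set m := (a + b + c) / 3 with hm
  have hpos : 0 < cross (m - a) (b - m) := by
    have hc : cross (b - a) (c - a) = -3 * cross (m - a) (b - m) := by
      have hre : m.re = (a.re + b.re + c.re) / 3 := by simp [hm]
      have him : m.im = (a.im + b.im + c.im) / 3 := by simp [hm]
      simp only [cross, Complex.sub_re, Complex.sub_im, hre, him]
      ring
    linarith
  -- The scale making `u = (m - a) / t` and `w = (b - m) / t` a symplectic basis.
  set t := √(cross (m - a) (b - m))
  have ht : 0 < t := Real.sqrt_pos.2 hpos
  have ht2 : t * t = cross (m - a) (b - m) := Real.mul_self_sqrt hpos.le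
  have htc : (t : ℂ) ≠ 0 := by exact_mod_cast ht.ne'
  obtain ⟨u, hu⟩ : ∃ u : ℂ, t * u = m - a := ⟨(m - a) / t, by field_simp⟩
  obtain ⟨w, hw⟩ : ∃ w : ℂ, t * w = b - m := ⟨(b - m) / t, by field_simp⟩
  have huw : cross u w = 1 := by
    rw [← hu, ← hw, cross_real_mul_left, cross_real_mul_right] at ht2
    have : t * t ≠ 0 := by positivity
    apply mul_left_cancel₀ this
    linarith
  have hwx : cross w (w - u) = 1 := by
    rw [← huw]; simp only [cross, Complex.sub_re, Complex.sub_im]; ring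
  have hxu : cross (w - u) (-u) = 1 := by
    rw [← huw]
    simp only [cross, Complex.sub_re, Complex.sub_im, Complex.neg_re, Complex.neg_im]; ring
  -- Any circle would do, since every nonzero vector is a spinor over it.
  let C₀ : ProperCircle := ⟨0, 1, one_pos⟩
  have hu0 : u ≠ 0 := by rintro rfl; simp [cross] at huw
  obtain ⟨D₁, θ₁, h₁, rfl⟩ := C₀.exists_touchesAt_spinor hu0
  obtain ⟨D₂, θ₂, h₂, rfl, lt₁₂, lt₁₂'⟩ :=
    exists_touchesAt_spinor_eq h₁ (η := w) (by rw [huw]; exact one_pos)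
  obtain ⟨D₃, θ₃, h₃, e₃, lt₂₃, lt₂₃'⟩ :=
    exists_touchesAt_spinor_eq h₂ (η := C₀.spinor D₂ θ₂ - C₀.spinor D₁ θ₁)
      (by rw [hwx]; exact one_pos)
  rw [← e₃] at hwx hxu
  rw [← spinor_add_two_pi] at hxu
  have lt₃₁ : θ₃ < θ₁ + 2 * Real.pi :=
    h₃.lt_of_cross_pos h₁.add_two_pi (by linarith) (by rw [hxu]; exact one_pos)
  have p₁₂ : TangentPair C₀ D₁ θ₁ D₂ θ₂ :=
    ⟨h₁, h₂, (h₁.tangent_iff_cross h₂ lt₁₂ lt₁₂').2 huw, lt₁₂, lt₁₂'⟩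
  have p₂₃ : TangentPair C₀ D₂ θ₂ D₃ θ₃ :=
    ⟨h₂, h₃, (h₂.tangent_iff_cross h₃ lt₂₃ lt₂₃').2 hwx, lt₂₃, lt₂₃'⟩
  have lt₃₁' : θ₁ + 2 * Real.pi < θ₃ + 2 * Real.pi := by linarith
  have p₃₁ : TangentPair C₀ D₃ θ₃ D₁ (θ₁ + 2 * Real.pi) :=
    ⟨h₃, h₁.add_two_pi, (h₃.tangent_iff_cross h₁.add_two_pi lt₃₁ lt₃₁').2 hxu, lt₃₁, lt₃₁'⟩
  refine ⟨_, C₀, D₁, D₂, D₃, θ₁, θ₂, θ₃, _, _, _,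
    { touches₁ := h₁
      touches₂ := h₂
      touches₃ := h₃
      tangent₁₂ := p₁₂.tangent
      tangent₂₃ := p₂₃.tangent
      tangent₃₁ := p₃₁.tangent
      lt₁₂ := lt₁₂
      lt₂₃ := lt₂₃
      lt₃₁ := lt₃₁
      curve₁₂ := p₁₂.isApollonianCurve a t
      curve₂₃ := p₂₃.isApollonianCurve b (-t)
      curve₃₁ := p₃₁.isApollonianCurve c t
      vertex₂ := ?_
      vertex₃ := ?_
      vertex₁ := ?_ }, ?_, rfl⟩
  · rw [p₁₂.apollonianCurve_right, p₂₃.apollonianCurve_left]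
    linear_combination hu + hw
  · rw [p₂₃.apollonianCurve_right, p₃₁.apollonianCurve_left, e₃]
    push_cast
    linear_combination hu - 2 * hw - 3 * hm
  · rw [p₃₁.apollonianCurve_right, p₁₂.apollonianCurve_left, e₃, spinor_add_two_pi]
    linear_combination hw - 2 * hu + 3 * hm
  · rw [p₁₂.apollonianCurve_left, p₂₃.apollonianCurve_left, p₃₁.apollonianCurve_left]

/-- An Apollonian triangle is determined by its vertices, listed in clockwise order. -/
lemma IsApollonianTriangle.eq_enclosedRegion {T : Set ℂ} {a b c : ℂ}
    (hT : IsApollonianTriangle T {a, b, c}) (h : cross (b - a) (c - a) < 0) :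
    T = enclosedRegion (apollonianBoundary a b c) := by
  obtain ⟨C₀, D₁, D₂, D₃, θ₁, θ₂, θ₃, γ₁₂, γ₂₃, γ₃₁, hc, hV, rfl⟩ := hT
  obtain ⟨hb, ho⟩ := hc.union_eq_apollonianBoundary
  rw [hb]
  congr 1
  generalize γ₁₂ θ₁ = x, γ₂₃ θ₂ = y, γ₃₁ θ₃ = z at hV ho
  have hab : a ≠ b := by rintro rfl; simp [cross] at h
  have hac : a ≠ c := by rintro rfl; simp [cross] at h
  have hbc : b ≠ c := by rintro rfl; exact h.ne (cross_self_eq_zero _)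
  have hx : x ∈ ({a, b, c} : Set ℂ) := by simp [hV]
  have hy : y ∈ ({a, b, c} : Set ℂ) := by simp [hV]
  have hz : z ∈ ({a, b, c} : Set ℂ) := by simp [hV]
  have ha : a ∈ ({x, y, z} : Set ℂ) := by simp [← hV]
  have hb : b ∈ ({x, y, z} : Set ℂ) := by simp [← hV]
  have hc : c ∈ ({x, y, z} : Set ℂ) := by simp [← hV]
  simp only [Set.mem_insert_iff, Set.mem_singleton_iff] at hx hy hz ha hb hc
  have hodd : ∀ p q r : ℂ, cross (q - p) (r - p) < 0 → ¬ cross (r - p) (q - p) ≤ 0 := by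
    intro p q r h1 h2
    rw [cross_swap] at h2
    linarith
  have hrot : ∀ p q r : ℂ, cross (r - q) (p - q) = cross (q - p) (r - p) := by
    intro p q r
    simp only [cross, Complex.sub_re, Complex.sub_im]
    ring
  have h' : cross (c - b) (a - b) < 0 := by rwa [hrot]
  have h'' : cross (a - c) (b - c) < 0 := by rwa [hrot]
  -- Of the 27 assignments, the cyclic ones give the same boundary, the transposed ones contradict
  -- the orientation, and those with a repetition miss a vertex.
  rcases hx with rfl | rfl | rfl <;> rcases hy with rfl | rfl | rfl <;>
    rcases hz with rfl | rfl | rfl <;>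
    first
    | rfl
    | exact apollonianBoundary_rotate _ _ _
    | exact (apollonianBoundary_rotate _ _ _).symm
    | exact absurd ho (hodd _ _ _ h)
    | exact absurd ho (hodd _ _ _ h')
    | exact absurd ho (hodd _ _ _ h'')
    | (exfalso; clear hodd hrot h h' h'' ho hV; grind)

lemma existsUnique_isApollonianTriangle {a b c : ℂ} (h : cross (b - a) (c - a) < 0) :
    ∃! T, IsApollonianTriangle T {a, b, c} := by
  obtain ⟨T, hT⟩ := exists_isApollonianTriangle h
  exact ⟨T, hT, fun T' hT' => (hT'.eq_enclosedRegion h).trans (hT.eq_enclosedRegion h).symm⟩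

lemma cross_ne_zero_of_affineIndependent {a b c : ℂ} (h : AffineIndependent ℝ ![a, b, c]) :
    cross (b - a) (c - a) ≠ 0 := by
  rw [affineIndependent_iff_not_collinear_set] at h
  intro h0
  apply h
  rcases eq_or_ne b a with rfl | hne
  · simpa using collinear_pair ℝ b c
  have hne' : b - a ≠ 0 := sub_ne_zero.2 hne
  have him : ((c - a) / (b - a)).im = 0 := by
    rw [Complex.div_im]
    have : Complex.normSq (b - a) ≠ 0 := (map_ne_zero _).2 hne'
    field_simp
    simp only [cross] at h0
    linear_combination h0
  rw [collinear_iff_of_mem (p₀ := a) (by simp)]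
  refine ⟨b - a, ?_⟩
  simp only [Set.mem_insert_iff, Set.mem_singleton_iff, vadd_eq_add, Complex.real_smul]
  rintro p (rfl | rfl | rfl)
  · exact ⟨0, by simp⟩
  · exact ⟨1, by simp⟩
  · refine ⟨((p - a) / (b - a)).re, ?_⟩
    have : (((p - a) / (b - a)).re : ℂ) = (p - a) / (b - a) := Complex.ext (by simp) (by simp [him])
    rw [this, div_mul_cancel₀ _ hne']
    ring

theorem theorem6 (v₁ v₂ v₃ : ℂ) (hv : AffineIndependent ℝ ![v₁, v₂, v₃]) :
    ∃! T : Set ℂ, IsApollonianTriangle T {v₁, v₂, v₃} := by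
  rcases (cross_ne_zero_of_affineIndependent hv).lt_or_gt with h | h
  · exact existsUnique_isApollonianTriangle h
  -- Counterclockwise vertices become clockwise when two of them are exchanged.
  · rw [Set.pair_comm v₂ v₃]
    exact existsUnique_isApollonianTriangle (by rw [cross_swap]; linarith)
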